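/- For complex $s_1,s_2,s_3$ put $$\zeta_2((s_1,s_2,s_3);PU(3))=\sum_{\substack{m,n\ge 1\\ m\equiv n\ (\mathrm{mod}\ 3)}}\frac{1}{m^{s_1}n^{s_2}(m+n)^{s_3}}$$ wherever this series converges absolutely, and let $\phi(s,\alpha)=\sum_{m\ge 1}e^{2\pi i m\alpha}m^{-s}$ ($\Re s>1$, $\alpha\in\mathbb{R}$) be the Lerch zeta function, continued meromorphically to $s\in\mathbb{C}$. Let $B_\tau(x)$ be the Bernoulli polynomials. Let $p,q\ge 1$ be integers. Then, for $\Re s>1$, the series defining $\zeta_2((p,q,s);PU(3))$, $\zeta_2((p,s,q);PU(3))$ and $\zeta_2((q,s,p);PU(3))$ converge absolutely, and as functions of $s$ they have meromorphic continuations to $\mathbb{C}$, which agree with the series wherever these converge absolutely and are denoted by the same symbols. They satisfy $$\begin{aligned} &3\Big\{\zeta_2((p,q,s);PU(3))+(-1)^p\zeta_2((p,s,q);PU(3))+(-1)^q\zeta_2((q,s,p);PU(3))\Big\}\\ &=-\sum_{\tau=0}^{p}\binom{p+q-\tau-1}{q-1}(-1)^\tau\frac{(2\pi i)^\tau}{\tau!}\sum_{a=0}^{2}B_\tau\!\left(\frac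 a3\right)\phi\!\left(s+p+q-\tau,-\frac a3\right)\\ &\quad-\sum_{\tau=0}^{q}\binom{p+q-\tau-1}{p-1}\frac{(2\pi i)^\tau}{\tau!}\sum_{a=0}^{2}B_\tau\!\left(\frac a3\right)\phi\!\left(s+p+q-\tau,\frac a3\right) \end{aligned}$$ for every $s\in\mathbb{C}$ that is not a singularity of the functions involved, that is, for every $s$ that is not a pole of any of the three continued functions on the left and satisfies $s+p+q-\tau\ne 1$ for all integers $0\le\tau\le\max(p,q)$. -/

import Mathlib

/-- The pairs `(m, n)` of positive integers with `m ≡ n (mod 3)`. -/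
def PU3Index : Type := {x : ℕ+ × ℕ+ // (x.1 : ℕ) ≡ (x.2 : ℕ) [MOD 3]}

/-- The summand `1 / (m ^ s₁ * n ^ s₂ * (m + n) ^ s₃)`. -/
noncomputable def zetaPU3Term (s₁ s₂ s₃ : ℂ) (x : PU3Index) : ℂ :=
  1 / (((x.1.1 : ℕ) : ℂ) ^ s₁ * ((x.1.2 : ℕ) : ℂ) ^ s₂ *
    (((x.1.1 : ℕ) : ℂ) + ((x.1.2 : ℕ) : ℂ)) ^ s₃)

/-- `Z` is the meromorphic continuation to the whole plane of
`s ↦ ∑ 1 / (m ^ s₁ * n ^ s₂ * (m + n) ^ s₃)`, the sum over `m, n ≥ 1` with `m ≡ n (mod 3)`,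
where `(s₁, s₂, s₃) = ℓ s`.

The series converges absolutely for `1 < s.re`; `Z` agrees with it wherever it converges absolutely
and is meromorphic on `ℂ` in normal form (analytic at each point that is not a pole, with the
default value `0` at the poles). Such a `Z` is unique. -/
structure IsZetaPU3Continuation (ℓ : ℂ → ℂ × ℂ × ℂ) (Z : ℂ → ℂ) : Prop where
  summable : ∀ s : ℂ, 1 < s.re → Summable (zetaPU3Term (ℓ s).1 (ℓ s).2.1 (ℓ s).2.2)
  eq_tsum : ∀ s : ℂ, Summable (zetaPU3Term (ℓ s).1 (ℓ s).2.1 (ℓ s).2.2) →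
    Z s = ∑' x, zetaPU3Term (ℓ s).1 (ℓ s).2.1 (ℓ s).2.2 x
  meromorphic : MeromorphicNFOn Z Set.univ

/-- The Lerch zeta function `φ(s, α)`, continued to all complex `s`
(for `α ∈ ℤ` it is the Riemann zeta function, with a pole at `s = 1`). -/
noncomputable def lerchPhi (s : ℂ) (α : ℝ) : ℂ := HurwitzZeta.expZeta (α : UnitAddCircle) s

/-- `φ(s, α) = ∑_{m ≥ 1} e ^ (2 π i m α) / m ^ s` for `1 < s.re`. -/
theorem hasSum_lerchPhi (α : ℝ) {s : ℂ} (hs : 1 < s.re) :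
    HasSum (fun m : ℕ+ => Complex.exp (2 * Real.pi * Complex.I * (m : ℕ) * α) / ((m : ℕ) : ℂ) ^ s)
      (lerchPhi s α) := by
  have hs0 : s ≠ 0 := by
    rintro rfl
    norm_num at hs
  have h := HurwitzZeta.hasSum_expZeta_of_one_lt_re α hs
  have hinj : Function.Injective (fun m : ℕ+ => (m : ℕ)) := PNat.coe_injective
  have h2 := (hinj.hasSum_iff (f := fun n : ℕ =>
    Complex.exp (2 * Real.pi * Complex.I * α * n) / (n : ℂ) ^ s) (a := lerchPhi s α) (by
      intro n hn
      have : n = 0 := by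
        by_contra h0
        exact hn ⟨⟨n, Nat.pos_of_ne_zero h0⟩, rfl⟩
      simp [this, Complex.zero_cpow hs0])).2 h
  refine h2.congr_fun ?_
  intro m
  simp only [Function.comp]
  congr 2
  ring

/-- The value `B_τ(x)` of the Bernoulli polynomial at a rational number, as a complex number. -/
noncomputable def bernoulliValue (τ : ℕ) (x : ℚ) : ℂ := (((Polynomial.bernoulli τ).eval x : ℚ) : ℂ)

/-! Grouping the first series by `N = m + n` and the other two by the variable carrying `s` turns
each into an ordinary Dirichlet series, with coefficients `convSum` and `tailSum`. Both the
continuation and the identity are then statements about these coefficients.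

Continuation. Partial fractions (`natCast_mul_convSum`, `natCast_mul_tailSum`) reduce the
coefficients, up to division by powers of `n`, to 3-periodic sequences and the partial sums
`powerSum`. Periodic sequences are combinations of additive characters, whose series are Lerch
functions. For `powerSum` the difference `a n - a (n - 3)` is elementary, and
`LSeriesContinues.of_sub_rshift` inverts the difference operator: expanding `(n + h) ^ (-s)`
binomially expresses the series of `a` at `s` through its values further right, which gains one unit
of half-plane per step.

Identity. For fixed `n`, the signed combination of coefficients (`signedSum`) is the sum of `1 / (x
^ p * (n - x) ^ q)` over all integers `x ≠ 0, n` with `x ≡ 2n (mod 3)`. It satisfies a Pascal-type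
recursion, solved by `eq_pascalSum_add`. The boundary data are sums of `1 / x ^ k` over a full
residue class: Fourier series of Bernoulli polynomials at `a / 3` for `k ≥ 2`
(`three_mul_tailSum_add`), and a cotangent value for the conditionally convergent `k = 1`
(`natCast_mul_tailSum_one_one_eq`). At `k = 1` the Bernoulli weights miss the principal value by
`±πi`, and the two errors cancel (`three_mul_signedSum`). Summing over `n` gives the identity for `1
< s.re`; the identity theorem carries it to the plane. -/

/-! ### Binomial expansion of `(1 + x) ^ (-s)` with remainder uniform in `s`. -/

section NegBinomial

open Complex Filter Topology Set

/-- The binomial coefficient `(-s choose k)` for complex `s`. -/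
noncomputable def negBinom : ℕ → ℂ → ℂ
  | 0, _ => 1
  | k + 1, s => -s * negBinom k (s + 1) / (k + 1)

theorem differentiable_negBinom (k : ℕ) : Differentiable ℂ (negBinom k) := by
  induction k with
  | zero => exact differentiable_const 1
  | succ k ih =>
    have : negBinom (k + 1) = fun s => -s * negBinom k (s + 1) / (k + 1) := rfl
    rw [this]
    fun_prop

/-- The remainder of order `K` in the binomial expansion of `(1 + x) ^ (-s)`. -/
noncomputable def binomRemainder (K : ℕ) (s : ℂ) (x : ℝ) : ℂ :=
  (1 + x : ℂ) ^ (-s) - ∑ k ∈ Finset.range K, negBinom k s * (x : ℂ) ^ k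

theorem differentiable_binomRemainder (K : ℕ) {x : ℝ} (hx : 0 ≤ x) :
    Differentiable ℂ (fun s => binomRemainder K s x) := by
  have h1 : (1 + x : ℂ) ≠ 0 := by
    exact_mod_cast (by positivity : (1 + x : ℝ) ≠ 0)
  unfold binomRemainder
  refine Differentiable.sub ?_ ?_
  · exact differentiable_neg.const_cpow (Or.inl h1)
  · exact Differentiable.fun_sum fun k _ => (differentiable_negBinom k).mul_const _

/-- Termwise this is the recursion defining `negBinom`. Lowering the order by one at the cost of `s
↦ s + 1` is what lets the remainder be bounded by induction. -/
theorem hasDerivAt_binomRemainder (K : ℕ) (s : ℂ) {x : ℝ} (hx : 0 ≤ x) :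
    HasDerivAt (binomRemainder (K + 1) s) (-s * binomRemainder K (s + 1) x) x := by
  have h1 : (1 + x : ℂ) ∈ slitPlane := by
    left
    simp only [add_re, one_re, ofReal_re]
    positivity
  have h2 : HasDerivAt (fun z : ℂ => (1 + z) ^ (-s)) (-s * (1 + x) ^ (-s - 1) * 1) (x : ℂ) :=
    ((hasDerivAt_id (x : ℂ)).const_add 1).cpow_const h1
  have h3 : HasDerivAt (fun z : ℂ => ∑ k ∈ Finset.range (K + 1), negBinom k s * z ^ k)
      (∑ k ∈ Finset.range (K + 1), negBinom k s * (k * (x : ℂ) ^ (k - 1))) (x : ℂ) := by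
    refine HasDerivAt.fun_sum fun k _ => ?_
    exact (hasDerivAt_pow k (x : ℂ)).const_mul _
  have h4 := (h2.sub h3).comp_ofReal
  refine h4.congr_deriv ?_
  rw [Finset.sum_range_succ', binomRemainder, mul_sub, Finset.mul_sum]
  simp only [Nat.cast_zero, zero_mul, mul_zero, add_zero, mul_one, negBinom]
  congr 1
  · congr 2
    ring
  · refine Finset.sum_congr rfl fun k _ => ?_
    have : (k + 1 : ℂ) ≠ 0 := by exact_mod_cast Nat.succ_ne_zero k
    push_cast
    field_simp

/-- The remainder of positive order vanishes at `0`, so the mean value inequality turns a bound of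
order `K` for its derivative into one of order `K + 1`. The radius `B` must vary in the induction
because the derivative involves `s + 1`. -/
theorem exists_norm_binomRemainder_le (K : ℕ) {X : ℝ} (hX : 0 ≤ X) (B : ℝ) :
    ∃ M : ℝ, 0 ≤ M ∧ ∀ s : ℂ, ‖s‖ ≤ B → ∀ x ∈ Icc 0 X, ‖binomRemainder K s x‖ ≤ M * x ^ K := by
  induction K generalizing B with
  | zero =>
    refine ⟨(1 + X) ^ B, by positivity, fun s hs x hx => ?_⟩
    have h1 : 0 < 1 + x := by linarith [hx.1]
    have : (1 + x : ℂ) = ((1 + x : ℝ) : ℂ) := by push_cast; rfl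
    simp only [binomRemainder, Finset.range_zero, Finset.sum_empty, sub_zero, pow_zero, mul_one]
    rw [this, norm_cpow_eq_rpow_re_of_pos h1]
    calc (1 + x) ^ (-s).re ≤ (1 + x) ^ B := by
          refine Real.rpow_le_rpow_of_exponent_le (by linarith [hx.1]) ?_
          have := (abs_le.1 (abs_re_le_norm s)).1
          simp only [neg_re]
          linarith
      _ ≤ (1 + X) ^ B := by
          rcases le_or_gt 0 B with hB | hB
          · exact Real.rpow_le_rpow h1.le (by linarith [hx.2]) hB
          · exact absurd ((norm_nonneg s).trans hs) (not_le.2 hB)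
  | succ K ih =>
    obtain ⟨M, hM, h⟩ := ih (B + 1)
    refine ⟨|B| * M, by positivity, fun s hs x hx => ?_⟩
    have h0 : binomRemainder (K + 1) s 0 = 0 := by
      simp [binomRemainder, Finset.sum_range_succ', negBinom]
    have key := norm_image_sub_le_of_norm_deriv_le_segment' (a := 0) (b := x)
      (f := binomRemainder (K + 1) s) (f' := fun t => -s * binomRemainder K (s + 1) t)
      (C := |B| * M * x ^ K)
      (fun t ht => (hasDerivAt_binomRemainder K s ht.1).hasDerivWithinAt)
      (fun t ht => ?_) x ⟨hx.1, le_rfl⟩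
    · rw [h0, sub_zero, sub_zero] at key
      calc _ ≤ _ := key
        _ = _ := by ring
    · rw [norm_mul, norm_neg, mul_assoc]
      have h5 := h (s + 1) ((norm_add_le _ _).trans (by simpa using hs)) t
        ⟨ht.1, ht.2.le.trans hx.2⟩
      have h6 : t ^ K ≤ x ^ K := pow_le_pow_left₀ ht.1 ht.2.le K
      gcongr
      · exact hs.trans (le_abs_self B)
      · exact h5.trans (by gcongr)

end NegBinomial

/-! ### Dirichlet series of shifted sequences. -/

section RightShift

open Complex Filter Topology Set

/-- The sequence `a` moved to the right by `h` places (entries with index `≤ h` are zero). -/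
def rshift (h : ℕ) (a : ℕ → ℂ) (n : ℕ) : ℂ := if h < n then a (n - h) else 0

/-- The part of the Dirichlet series of `rshift h a` not accounted for by the first `K` terms of
the binomial expansion. -/
noncomputable def shiftRemainder (h K : ℕ) (a : ℕ → ℂ) (s : ℂ) : ℂ :=
  ∑' n : ℕ, LSeries.term a s n * binomRemainder K s ((h : ℝ) / n)

theorem div_natCast_mem_Icc (h n : ℕ) : (h : ℝ) / n ∈ Icc (0 : ℝ) h := by
  refine ⟨by positivity, ?_⟩
  rcases Nat.eq_zero_or_pos n with rfl | hn
  · simp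
  · exact div_le_self (by positivity) (by exact_mod_cast hn)

/-- The remainder is `O(n ^ (-K))`, so absolute convergence at `c` yields convergence down to `c -
K`, uniformly on bounded sets; holomorphy of `shiftRemainder` follows. -/
theorem exists_norm_shiftRemainder_term_le (h K : ℕ) (a : ℕ → ℂ) (c B : ℝ) :
    ∃ M : ℝ, ∀ s : ℂ, ‖s‖ ≤ B → c ≤ s.re + K → ∀ n : ℕ,
      ‖LSeries.term a s n * binomRemainder K s ((h : ℝ) / n)‖ ≤ M * ‖LSeries.term a c n‖ := by
  obtain ⟨M, hM, hb⟩ := exists_norm_binomRemainder_le K (Nat.cast_nonneg h) B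
  refine ⟨M * h ^ K, fun s hs hc n => ?_⟩
  rcases eq_or_ne n 0 with rfl | hn
  · simp
  have hn1 : (1 : ℝ) ≤ n := by exact_mod_cast Nat.one_le_iff_ne_zero.2 hn
  have hn0 : (0 : ℝ) < n := by linarith
  rw [norm_mul]
  have h1 := hb s hs _ (div_natCast_mem_Icc h n)
  have h2 : ‖LSeries.term a s n‖ * (1 / (n : ℝ) ^ K) ≤ ‖LSeries.term a c n‖ := by
    rw [LSeries.norm_term_eq, LSeries.norm_term_eq, if_neg hn, if_neg hn, div_mul_div_comm,
      mul_one, ← Real.rpow_natCast, ← Real.rpow_add hn0, ofReal_re]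
    gcongr
  calc _ ≤ ‖LSeries.term a s n‖ * (M * ((h : ℝ) / n) ^ K) := by gcongr
    _ = M * h ^ K * (‖LSeries.term a s n‖ * (1 / (n : ℝ) ^ K)) := by
        rw [div_pow]; ring
    _ ≤ _ := by gcongr

theorem summable_shiftRemainder_term (h K : ℕ) {a : ℕ → ℂ} {c : ℝ} (hc : LSeriesSummable a c)
    {s : ℂ} (hs : c ≤ s.re + K) :
    Summable fun n : ℕ => LSeries.term a s n * binomRemainder K s ((h : ℝ) / n) := by
  obtain ⟨M, hM⟩ := exists_norm_shiftRemainder_term_le h K a c ‖s‖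
  exact Summable.of_norm_bounded (hc.norm.mul_left M) (hM s le_rfl hs)

theorem differentiable_LSeries_term (a : ℕ → ℂ) (n : ℕ) :
    Differentiable ℂ fun s => LSeries.term a s n := by
  rcases eq_or_ne n 0 with rfl | hn
  · simp
  · have h0 : (n : ℂ) ≠ 0 := by exact_mod_cast hn
    simp only [LSeries.term_of_ne_zero hn]
    refine Differentiable.div (differentiable_const _)
      (differentiable_id.const_cpow (Or.inl h0)) fun s => ?_
    simp [cpow_eq_zero_iff, h0]

theorem differentiableOn_shiftRemainder (h K : ℕ) {a : ℕ → ℂ} {c : ℝ}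
    (hc : LSeriesSummable a c) :
    DifferentiableOn ℂ (shiftRemainder h K a) {s | c < s.re + K} := by
  intro s hs
  obtain ⟨M, hM⟩ := exists_norm_shiftRemainder_term_le h K a c (‖s‖ + 1)
  have hopen : IsOpen ({w : ℂ | c < w.re + K} ∩ Metric.ball s 1) := by
    refine IsOpen.inter (isOpen_lt continuous_const ?_) Metric.isOpen_ball
    fun_prop
  have := differentiableOn_tsum_of_summable_norm (F := fun n (w : ℂ) =>
      LSeries.term a w n * binomRemainder K w ((h : ℝ) / n)) (hc.norm.mul_left M)
    (fun n => ((differentiable_LSeries_term a n).mul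
      (differentiable_binomRemainder K (div_natCast_mem_Icc h n).1)).differentiableOn)
    hopen (fun n w hw => hM w ?_ hw.1.le n)
  · exact (this.differentiableAt (hopen.mem_nhds ⟨hs, Metric.mem_ball_self one_pos⟩)).differentiableWithinAt
  · have := norm_sub_norm_le w s
    have h2 := hw.2
    rw [Metric.mem_ball, dist_eq] at h2
    linarith

theorem term_rshift (h : ℕ) (a : ℕ → ℂ) (s : ℂ) (K n : ℕ) :
    LSeries.term (rshift h a) s (n + h) =
      LSeries.term a s n * binomRemainder K s ((h : ℝ) / n) +
      ∑ k ∈ Finset.range K, negBinom k s * (h : ℂ) ^ k * LSeries.term a (s + k) n := by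
  -- At `n = 0` both sides vanish: the strict inequality in `rshift` makes its entry at index `h`
  -- zero.
  rcases eq_or_ne n 0 with rfl | hn
  · rcases eq_or_ne h 0 with rfl | hh
    · simp
    · simp [LSeries.term, rshift]
  have hn0 : (n : ℂ) ≠ 0 := by exact_mod_cast hn
  have hnr : (0 : ℝ) < n := by exact_mod_cast Nat.pos_of_ne_zero hn
  have h1 : ∀ k ∈ Finset.range K, negBinom k s * (h : ℂ) ^ k * LSeries.term a (s + k) n =
      LSeries.term a s n * (negBinom k s * (((h : ℝ) / n : ℝ) : ℂ) ^ k) := by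
    intro k _
    rw [LSeries.term_of_ne_zero hn, LSeries.term_of_ne_zero hn, cpow_add _ _ hn0, cpow_natCast]
    push_cast
    rw [div_pow]
    field_simp
  rw [Finset.sum_congr rfl h1, ← Finset.mul_sum, ← mul_add, binomRemainder, sub_add_cancel,
    LSeries.term_of_ne_zero (by omega), LSeries.term_of_ne_zero hn, rshift, if_pos (by omega),
    Nat.add_sub_cancel]
  have h2 : ((n + h : ℕ) : ℂ) = ((n : ℝ) : ℂ) * ((1 + (h : ℝ) / n : ℝ) : ℂ) := by
    push_cast
    field_simp
  have h3 : (1 + (((h : ℝ) / n : ℝ) : ℂ)) = ((1 + (h : ℝ) / n : ℝ) : ℂ) := by push_cast; rfl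
  rw [h2, mul_cpow_ofReal_nonneg hnr.le (by positivity), h3, cpow_neg]
  rw [div_mul_eq_div_div, ofReal_natCast, div_eq_mul_inv (a n / _)]

theorem LSeriesHasSum_rshift (h K : ℕ) {a : ℕ → ℂ} {c : ℝ} (hc : LSeriesSummable a c)
    {s : ℂ} (hs : c ≤ s.re) :
    LSeriesHasSum (rshift h a) s (shiftRemainder h K a s +
      ∑ k ∈ Finset.range K, negBinom k s * (h : ℂ) ^ k * LSeries a (s + k)) := by
  have h1 : HasSum (fun n => LSeries.term (rshift h a) s (n + h)) (shiftRemainder h K a s +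
      ∑ k ∈ Finset.range K, negBinom k s * (h : ℂ) ^ k * LSeries a (s + k)) := by
    simp only [term_rshift h a s K]
    refine HasSum.add (summable_shiftRemainder_term h K hc ?_).hasSum (hasSum_sum fun k _ => ?_)
    · have : (0 : ℝ) ≤ K := by positivity
      linarith
    · refine HasSum.mul_left _ (LSeriesSummable.LSeriesHasSum (hc.of_re_le_re ?_))
      simp only [ofReal_re, add_re, natCast_re]
      have : (0 : ℝ) ≤ k := by positivity
      linarith
  have hinj : Function.Injective (fun n : ℕ => n + h) := add_left_injective h
  refine (hinj.hasSum_iff ?_).1 h1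
  intro n hn
  rcases eq_or_ne n 0 with rfl | hn0
  · simp
  rw [LSeries.term_of_ne_zero hn0, rshift, if_neg, zero_div]
  intro hlt
  exact hn ⟨n - h, by simp; omega⟩

end RightShift

/-! ### Closure properties of meromorphic continuation of Dirichlet series. -/

section Continuation

open Complex Filter Topology Set

theorem isOpen_lt_re (A : ℝ) : IsOpen {s : ℂ | A < s.re} := isOpen_lt continuous_const continuous_re

theorem isPreconnected_lt_re (A : ℝ) : IsPreconnected {s : ℂ | A < s.re} :=
  (convex_halfSpace_re_gt A).isPreconnected

/-- Meromorphic functions on a right half-plane which agree far to the right agree near each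
point. -/
theorem MeromorphicOn.eventuallyEq_of_eq_re {f g : ℂ → ℂ} {A c : ℝ}
    (hf : MeromorphicOn f {s | A < s.re}) (hg : MeromorphicOn g {s | A < s.re})
    (h : ∀ s : ℂ, c < s.re → f s = g s) {z : ℂ} (hz : A < z.re) : f =ᶠ[𝓝[≠] z] g := by
  have hfg := hf.sub hg
  by_contra hne
  have h1 : meromorphicOrderAt (f - g) z ≠ ⊤ := by
    intro htop
    refine hne ?_
    filter_upwards [meromorphicOrderAt_eq_top_iff.1 htop] with w hw
    exact sub_eq_zero.1 hw
  have hy : (((max A c + 1 : ℝ) : ℂ)) ∈ {s : ℂ | A < s.re} := by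
    simp only [mem_ofPred_eq, ofReal_re]
    linarith [le_max_left A c]
  refine hfg.meromorphicOrderAt_ne_top_of_isPreconnected (isPreconnected_lt_re A) hz hy h1 ?_
  refine meromorphicOrderAt_eq_top_iff.2 (nhdsWithin_le_nhds ?_)
  have : {s : ℂ | c < s.re} ∈ 𝓝 ((max A c + 1 : ℝ) : ℂ) := by
    refine (isOpen_lt_re c).mem_nhds ?_
    simp only [mem_ofPred_eq, ofReal_re]
    linarith [le_max_right A c]
  filter_upwards [this] with w hw
  simp [h w hw]

/-- The Dirichlet series of `a` converges absolutely somewhere and has a meromorphic continuation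
to every right half-plane. -/
def LSeriesContinues (a : ℕ → ℂ) : Prop :=
  ∀ A : ℝ, ∃ f : ℂ → ℂ, MeromorphicOn f {s | A < s.re} ∧
    ∃ c : ℝ, ∀ s : ℂ, c < s.re → LSeriesHasSum a s (f s)

theorem LSeriesContinues.exists_summable {a : ℕ → ℂ} (ha : LSeriesContinues a) :
    ∃ c : ℝ, LSeriesSummable a c := by
  obtain ⟨f, -, c, hc⟩ := ha 0
  exact ⟨((c + 1 : ℝ)), (hc ((c + 1 : ℝ) : ℂ) (by simp)).LSeriesSummable⟩

theorem LSeriesContinues.congr {a b : ℕ → ℂ} (ha : LSeriesContinues a)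
    (h : ∀ n, n ≠ 0 → a n = b n) : LSeriesContinues b := by
  intro A
  obtain ⟨f, hf, c, hc⟩ := ha A
  exact ⟨f, hf, c, fun s hs => (LSeriesHasSum_congr s _ (fun {n} hn => h n hn)).1 (hc s hs)⟩

theorem LSeriesContinues.add {a b : ℕ → ℂ} (ha : LSeriesContinues a) (hb : LSeriesContinues b) :
    LSeriesContinues (a + b) := by
  intro A
  obtain ⟨f, hf, c, hc⟩ := ha A
  obtain ⟨g, hg, d, hd⟩ := hb A
  exact ⟨f + g, hf.add hg, max c d, fun s hs =>
    (hc s ((le_max_left _ _).trans_lt hs)).add (hd s ((le_max_right _ _).trans_lt hs))⟩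

theorem LSeriesContinues.smul {a : ℕ → ℂ} (ha : LSeriesContinues a) (k : ℂ) :
    LSeriesContinues (k • a) := by
  intro A
  obtain ⟨f, hf, c, hc⟩ := ha A
  exact ⟨k • f, fun z hz => (hf z hz).const_smul k, c, fun s hs => (hc s hs).smul k⟩

theorem LSeriesContinues.sub {a b : ℕ → ℂ} (ha : LSeriesContinues a) (hb : LSeriesContinues b) :
    LSeriesContinues (a - b) :=
  (ha.add (hb.smul (-1))).congr fun n _ => by simp [sub_eq_add_neg]

theorem LSeriesContinues.zero : LSeriesContinues 0 := fun _ =>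
  ⟨fun _ => 0, MeromorphicOn.const 0, 0, fun s _ => by
    simpa using (LSeriesSummable_zero (s := s)).LSeriesHasSum⟩

theorem LSeriesContinues.sum {ι : Type*} (S : Finset ι) {a : ι → ℕ → ℂ}
    (ha : ∀ i ∈ S, LSeriesContinues (a i)) : LSeriesContinues (∑ i ∈ S, a i) :=
  Finset.sum_induction a LSeriesContinues (fun _ _ h1 h2 => h1.add h2) LSeriesContinues.zero ha

theorem MeromorphicOn.comp_add_right_re {f : ℂ → ℂ} {A B : ℝ} {w : ℂ}
    (hf : MeromorphicOn f {s | A < s.re}) (h : A ≤ B + w.re) :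
    MeromorphicOn (fun s => f (s + w)) {s | B < s.re} := by
  intro z hz
  have h1 : MeromorphicAt f (z + w) := hf (z + w) (by
    simp only [mem_ofPred_eq, add_re] at hz ⊢
    linarith)
  exact h1.comp_analyticAt (g := fun s => s + w) (by fun_prop)

theorem LSeries.term_div_pow (a : ℕ → ℂ) (k : ℕ) (s : ℂ) :
    LSeries.term (fun n => a n / (n : ℂ) ^ k) s = LSeries.term a (s + k) := by
  ext n
  rcases eq_or_ne n 0 with rfl | hn
  · simp
  have hn0 : (n : ℂ) ≠ 0 := by exact_mod_cast hn
  rw [LSeries.term_of_ne_zero hn, LSeries.term_of_ne_zero hn, cpow_add _ _ hn0, cpow_natCast,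
    div_div, mul_comm]

theorem LSeriesHasSum_div_pow {a : ℕ → ℂ} {k : ℕ} {s x : ℂ} :
    LSeriesHasSum (fun n => a n / (n : ℂ) ^ k) s x ↔ LSeriesHasSum a (s + k) x := by
  rw [LSeriesHasSum, LSeriesHasSum, LSeries.term_div_pow]

theorem LSeriesContinues.div_pow {a : ℕ → ℂ} (ha : LSeriesContinues a) (k : ℕ) :
    LSeriesContinues fun n => a n / (n : ℂ) ^ k := by
  intro A
  obtain ⟨f, hf, c, hc⟩ := ha A
  refine ⟨fun s => f (s + k), hf.comp_add_right_re ?_, c, fun s hs =>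
    LSeriesHasSum_div_pow.2 (hc _ ?_)⟩
  · simp
  · simp only [add_re, natCast_re]
    have : (0 : ℝ) ≤ k := by positivity
    linarith

theorem meromorphicOn_shiftRemainder (h K : ℕ) {a : ℕ → ℂ} {c : ℝ}
    (hc : LSeriesSummable a c) {A : ℝ} (hA : c ≤ A + K) :
    MeromorphicOn (shiftRemainder h K a) {s | A < s.re} := by
  have hsub : {s : ℂ | A < s.re} ⊆ {s | c < s.re + K} := by
    intro s hs
    simp only [mem_ofPred_eq] at hs ⊢
    linarith
  exact (((differentiableOn_shiftRemainder h K hc).mono hsub).analyticOnNhd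
    (isOpen_lt_re A)).meromorphicOn

theorem meromorphicAt_negBinom (k : ℕ) (s : ℂ) : MeromorphicAt (negBinom k) s :=
  ((differentiable_negBinom k).analyticAt s).meromorphicAt

theorem LSeriesContinues.rshift {a : ℕ → ℂ} (ha : LSeriesContinues a) (h : ℕ) :
    LSeriesContinues (rshift h a) := by
  intro A
  obtain ⟨c, hc⟩ := ha.exists_summable
  obtain ⟨K, hK⟩ := exists_nat_ge (c - A)
  obtain ⟨f, hf, d, hd⟩ := ha A
  refine ⟨fun s => shiftRemainder h K a s +
      ∑ k ∈ Finset.range K, negBinom k s * (h : ℂ) ^ k * f (s + k), ?_, max c d, fun s hs => ?_⟩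
  · intro z hz
    refine (meromorphicOn_shiftRemainder h K hc (by linarith) z hz).add
      (MeromorphicAt.fun_sum fun k _ => ?_)
    exact ((meromorphicAt_negBinom k z).mul (MeromorphicAt.const _ z)).mul
      (hf.comp_add_right_re (B := A) (by simp) z hz)
  · have h1 := LSeriesHasSum_rshift h K hc (s := s) ((le_max_left _ _).trans hs.le)
    have h2 : ∀ k ∈ Finset.range K, negBinom k s * (h : ℂ) ^ k * f (s + k) =
        negBinom k s * (h : ℂ) ^ k * LSeries a (s + k) := by
      intro k _
      rw [(hd (s + k) ?_).LSeries_eq]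
      have h3 := (le_max_right c d).trans_lt hs
      have : (0 : ℝ) ≤ k := by positivity
      simp only [add_re, natCast_re]
      linarith
    simp only [Finset.sum_congr rfl h2]
    exact h1

/-- If the differences `a n - a (n - h)` give a Dirichlet series which continues meromorphically,
so does `a`. -/
theorem LSeriesContinues.of_sub_rshift {a : ℕ → ℂ} {h : ℕ} (hh : h ≠ 0) {c : ℝ}
    (hc : LSeriesSummable a c) (hb : LSeriesContinues (a - _root_.rshift h a)) :
    LSeriesContinues a := by
  -- Each step of the induction moves the boundary of the half-plane one unit to the left.
  have key : ∀ j : ℕ, ∃ f : ℂ → ℂ, MeromorphicOn f {s | c - j < s.re} ∧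
      ∃ d : ℝ, ∀ s : ℂ, d < s.re → LSeriesHasSum a s (f s) := by
    intro j
    induction j with
    | zero =>
      refine ⟨LSeries a, ?_, c, fun s hs => (hc.of_re_le_re (by simpa using hs.le)).LSeriesHasSum⟩
      intro z hz
      refine (LSeries_analyticOnNhd a z ?_).meromorphicAt
      refine hc.abscissaOfAbsConv_le.trans_lt ?_
      simpa using hz
    | succ j ih =>
      obtain ⟨f, hf, d, hd⟩ := ih
      obtain ⟨g, hg, d', hd'⟩ := hb (c - j - 2)
      have hh0 : (h : ℂ) ≠ 0 := by exact_mod_cast hh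
      -- Expand the shifted series at `s - 1` to order `j + 2`. In the difference the term of order
      -- 0 cancels and the term of order 1 is `(s - 1) * h` times the series at `s`. Solving for the
      -- latter leaves only arguments `s + 1, s + 2, ...`, where the previous `f` is available, and
      -- a remainder.
      refine ⟨fun s => (g (s + (-1)) + ∑ k ∈ Finset.range j, negBinom (k + 2) (s + (-1)) *
          (h : ℂ) ^ (k + 2) * f (s + (k + 1)) + shiftRemainder h (j + 2) a (s + (-1))) /
          ((s + (-1)) * h), ?_, max (max c d) (max d' 0) + 1, fun s hs => ?_⟩
      · intro z hz
        have hz' : c - j - 1 < z.re := by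
          have : c - ((j + 1 : ℕ) : ℝ) < z.re := hz
          push_cast at this
          linarith
        refine MeromorphicAt.fun_div (MeromorphicAt.fun_add (MeromorphicAt.fun_add ?_
          (MeromorphicAt.fun_sum fun k _ => MeromorphicAt.fun_mul (MeromorphicAt.fun_mul ?_ ?_) ?_))
          ?_) ?_
        · exact hg.comp_add_right_re (B := c - j - 1) (by simp; linarith) z hz'
        · exact (meromorphicAt_negBinom (k + 2) (z + (-1))).comp_analyticAt
            (g := fun s => s + (-1)) (by fun_prop)
        · exact MeromorphicAt.const _ _
        · refine hf.comp_add_right_re (B := c - j - 1) ?_ z hz'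
          have : (0 : ℝ) ≤ k := by positivity
          simp only [add_re, natCast_re, one_re]
          linarith
        · refine (meromorphicOn_shiftRemainder h (j + 2) hc (A := c - j - 2)
            (by push_cast; linarith)).comp_add_right_re (B := c - j - 1) (by simp; linarith) z hz'
        · fun_prop
      · have hm1 := le_max_left (max c d) (max d' 0)
        have hm2 := le_max_right (max c d) (max d' 0)
        have hm3 := le_max_left c d
        have hm4 := le_max_right c d
        have hm5 := le_max_left d' 0
        have hm6 := le_max_right d' 0
        have hre : (s + (-1)).re = s.re - 1 := by simp [sub_eq_add_neg]
        have hs1 : s + (-1) ≠ 0 := by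
          intro h0
          have := congrArg re h0
          rw [hre, zero_re] at this
          linarith
        have h1 := LSeriesHasSum_rshift h (j + 2) hc (s := s + (-1)) (by rw [hre]; linarith)
        have h2 : LSeriesHasSum a (s + (-1)) (LSeries a (s + (-1))) :=
          (hc.of_re_le_re (by rw [hre, ofReal_re]; linarith)).LSeriesHasSum
        have h3 := HasSum.unique (h2.sub h1) (hd' (s + (-1)) (by rw [hre]; linarith))
        have h4 : LSeriesHasSum a s (LSeries a s) :=
          (hc.of_re_le_re (by rw [ofReal_re]; linarith)).LSeriesHasSum
        convert h4 using 1
        have h5 : ∀ k ∈ Finset.range j, negBinom (k + 2) (s + (-1)) *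
            (h : ℂ) ^ (k + 2) * f (s + (k + 1)) = negBinom (k + 1 + 1) (s + (-1)) *
            (h : ℂ) ^ (k + 1 + 1) * LSeries a (s + (-1) + ((k + 1 + 1 : ℕ) : ℂ)) := by
          intro k _
          have h6 : s + (-1) + ((k + 1 + 1 : ℕ) : ℂ) = s + (k + 1) := by push_cast; ring
          rw [h6, (hd (s + (k + 1)) ?_).LSeries_eq]
          have : (0 : ℝ) ≤ k := by positivity
          simp only [add_re, natCast_re, one_re]
          linarith
        beta_reduce
        rw [Finset.sum_congr rfl h5, div_eq_iff (mul_ne_zero hs1 hh0), ← h3,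
          Finset.sum_range_succ', Finset.sum_range_succ']
        have h7 : s + (-1) + ((0 + 1 : ℕ) : ℂ) = s := by push_cast; ring
        rw [h7]
        simp only [negBinom, Nat.cast_zero, add_zero, zero_add, pow_zero, pow_one, Nat.cast_zero]
        ring
  intro A
  obtain ⟨j, hj⟩ := exists_nat_ge (c - A)
  obtain ⟨f, hf, d, hd⟩ := key j
  refine ⟨f, hf.mono_set fun s hs => ?_, d, hd⟩
  simp only [mem_ofPred_eq] at hs ⊢
  linarith

/-- The continuations to half-planes glue to a meromorphic function on the plane. -/
theorem LSeriesContinues.exists_meromorphic {a : ℕ → ℂ} (ha : LSeriesContinues a) :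
    ∃ Z : ℂ → ℂ, Meromorphic Z ∧ ∃ c : ℝ, ∀ s : ℂ, c < s.re → LSeriesHasSum a s (Z s) := by
  choose F hF c hc using fun n : ℕ => ha (-(n : ℝ))
  have hagree : ∀ m n : ℕ, ∀ z : ℂ, -(m : ℝ) < z.re → -(n : ℝ) < z.re → F m =ᶠ[𝓝[≠] z] F n := by
    intro m n z hm hn
    refine MeromorphicOn.eventuallyEq_of_eq_re (A := max (-(m : ℝ)) (-(n : ℝ)))
      (c := max (c m) (c n)) ((hF m).mono_set ?_) ((hF n).mono_set ?_) ?_ (max_lt hm hn)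
    · exact fun s hs => (le_max_left (-(m : ℝ)) _).trans_lt hs
    · exact fun s hs => (le_max_right (-(m : ℝ)) (-(n : ℝ))).trans_lt hs
    · exact fun s hs => HasSum.unique (hc m s ((le_max_left _ _).trans_lt hs))
        (hc n s ((le_max_right _ _).trans_lt hs))
  -- The index depends on `s` but is bounded near each `z`, so only finitely many pieces occur
  -- there, and they agree on a punctured neighbourhood.
  refine ⟨fun s => F (⌈-s.re⌉₊ + 1) s, fun z => ?_, max (c 1) 0, fun s hs => ?_⟩
  · set N := ⌈-z.re + 1⌉₊ + 1 with hN
    have hzN : -(N : ℝ) < z.re := by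
      have := Nat.le_ceil (-z.re + 1)
      rw [hN]
      push_cast
      linarith
    refine (hF N z hzN).congr ?_
    have h1 : ∀ᶠ w in 𝓝[≠] z, ∀ n ∈ Finset.range (N + 1), -(n : ℝ) < z.re → F N w = F n w := by
      rw [Filter.eventually_all_finset]
      intro n _
      by_cases hn : -(n : ℝ) < z.re
      · filter_upwards [hagree N n z hzN hn] with w hw _
        exact hw
      · exact Eventually.of_forall fun w h => absurd h hn
    have h2 : ∀ᶠ w in 𝓝[≠] z, ‖w - z‖ < 1 := by
      refine nhdsWithin_le_nhds ?_
      filter_upwards [Metric.ball_mem_nhds z one_pos] with w hw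
      rwa [← dist_eq]
    filter_upwards [h1, h2] with w hw1 hw2
    have hre := abs_lt.1 ((abs_re_le_norm (w - z)).trans_lt hw2)
    rw [sub_re] at hre
    refine hw1 _ ?_ ?_
    · rw [Finset.mem_range, hN]
      have : ⌈-w.re⌉₊ ≤ ⌈-z.re + 1⌉₊ := Nat.ceil_mono (by linarith)
      omega
    · have := Nat.le_ceil (-w.re)
      push_cast
      linarith
  · have h0 : ⌈-s.re⌉₊ = 0 := by
      rw [Nat.ceil_eq_zero]
      linarith [le_max_right (c 1) 0]
    simp only [h0]
    exact hc 1 s ((le_max_left _ _).trans_lt hs)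

end Continuation

/-! ### Agreement of the continuation with the series up to the boundary of convergence. -/

section GeneralizedDirichletSeries

open Complex Filter Topology Set

variable {ι : Type*} {w : ι → ℂ} {b : ι → ℕ}

theorem norm_div_natCast_cpow_le (w : ℂ) {b : ℕ} (hb : 1 ≤ b) {s t : ℂ} (h : s.re ≤ t.re) :
    ‖w / (b : ℂ) ^ t‖ ≤ ‖w / (b : ℂ) ^ s‖ := by
  rw [norm_div, norm_div, norm_natCast_cpow_of_pos hb, norm_natCast_cpow_of_pos hb]
  have h1 : (1 : ℝ) ≤ b := by exact_mod_cast hb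
  gcongr

theorem differentiable_div_natCast_cpow (w : ℂ) {b : ℕ} (hb : 1 ≤ b) :
    Differentiable ℂ fun s : ℂ => w / (b : ℂ) ^ s := by
  have h0 : (b : ℂ) ≠ 0 := by exact_mod_cast (by omega : b ≠ 0)
  refine Differentiable.div (differentiable_const _)
    (differentiable_id.const_cpow (Or.inl h0)) fun s => ?_
  simp [cpow_eq_zero_iff, h0]

theorem differentiableOn_tsum_div_natCast_cpow (hb : ∀ x, 1 ≤ b x) {s : ℂ}
    (hs : Summable fun x => w x / (b x : ℂ) ^ s) :
    DifferentiableOn ℂ (fun z : ℂ => ∑' x, w x / (b x : ℂ) ^ z) {z | s.re < z.re} :=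
  differentiableOn_tsum_of_summable_norm hs.norm
    (fun x => (differentiable_div_natCast_cpow (w x) (hb x)).differentiableOn) (isOpen_lt_re _)
    fun x _ hz => norm_div_natCast_cpow_le (w x) (hb x) (le_of_lt hz)

theorem continuousOn_tsum_div_natCast_cpow (hb : ∀ x, 1 ≤ b x) {s : ℂ}
    (hs : Summable fun x => w x / (b x : ℂ) ^ s) :
    ContinuousOn (fun z : ℂ => ∑' x, w x / (b x : ℂ) ^ z) {z | s.re ≤ z.re} :=
  continuousOn_tsum
    (fun x => (differentiable_div_natCast_cpow (w x) (hb x)).continuous.continuousOn) hs.norm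
    fun x _ hz => norm_div_natCast_cpow_le (w x) (hb x) hz

/-- The normal form of a meromorphic continuation of a generalized Dirichlet series agrees with
the series wherever this converges absolutely. -/
theorem toMeromorphicNFOn_eq_tsum_of_summable {Z : ℂ → ℂ} (hZ : Meromorphic Z)
    (hb : ∀ x, 1 ≤ b x) {c : ℝ} (hc : ∀ z : ℂ, c < z.re → Z z = ∑' x, w x / (b x : ℂ) ^ z) {s : ℂ}
    (hs : Summable fun x => w x / (b x : ℂ) ^ s) :
    toMeromorphicNFOn Z univ s = ∑' x, w x / (b x : ℂ) ^ s := by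
  set W := toMeromorphicNFOn Z univ
  set G : ℂ → ℂ := fun z => ∑' x, w x / (b x : ℂ) ^ z
  have hZ' : MeromorphicOn Z univ := hZ.meromorphicOn
  have hW : MeromorphicNFOn W univ := meromorphicNFOn_toMeromorphicNFOn Z univ
  have hG : AnalyticOnNhd ℂ G {z | s.re < z.re} :=
    (differentiableOn_tsum_div_natCast_cpow hb hs).analyticOnNhd (isOpen_lt_re _)
  have h1 : ∀ z : ℂ, s.re < z.re → W z = G z := by
    intro z hz
    have h2 : Z =ᶠ[𝓝[≠] z] G :=
      MeromorphicOn.eventuallyEq_of_eq_re (hZ.meromorphicOn) hG.meromorphicOn hc hz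
    have h3 : W =ᶠ[𝓝[≠] z] Z := hZ'.toMeromorphicNFOn_eq_self_on_nhdsNE (mem_univ z)
    exact (((hW (mem_univ z)).eventuallyEq_nhdsNE_iff_eventuallyEq_nhds
      (hG z hz).meromorphicNFAt).1 (h3.trans h2)).eq_of_nhds
  -- Convergence at `s` gives holomorphy of `G` only strictly to the right, so `s` is treated as a
  -- boundary point: the limit from the right is finite, which excludes a pole of `W`, and
  -- continuity then identifies the value.
  have hcl : s ∈ closure {z : ℂ | s.re < z.re} := by
    rw [closure_setOfPred_lt_re]
    exact le_refl s.re
  have : (𝓝[{z : ℂ | s.re < z.re}] s).NeBot := mem_closure_iff_nhdsWithin_neBot.1 hcl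
  have h4 : Tendsto W (𝓝[{z : ℂ | s.re < z.re}] s) (𝓝 (G s)) := by
    have h5 : Tendsto G (𝓝[{z : ℂ | s.re < z.re}] s) (𝓝 (G s)) :=
      (continuousOn_tsum_div_natCast_cpow hb hs s (le_refl s.re)).mono_left
        (nhdsWithin_mono _ fun z hz => show s.re ≤ z.re from le_of_lt hz)
    refine h5.congr' ?_
    filter_upwards [self_mem_nhdsWithin] with z hz
    exact (h1 z hz).symm
  have hle : 𝓝[{z : ℂ | s.re < z.re}] s ≤ 𝓝[≠] s := by
    refine nhdsWithin_mono _ fun z hz => ?_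
    rintro rfl
    exact lt_irrefl z.re hz
  have hord : 0 ≤ meromorphicOrderAt W s := by
    by_contra hneg
    have h6 := (tendsto_cobounded_of_meromorphicOrderAt_neg (not_le.1 hneg)).mono_left hle
    exact (tendsto_norm_cobounded_atTop.comp h6).not_tendsto (disjoint_nhds_atTop _).symm h4.norm
  have hWs : AnalyticAt ℂ W s :=
    (hW (mem_univ s)).meromorphicOrderAt_nonneg_iff_analyticAt.1 hord
  exact tendsto_nhds_unique (hWs.continuousAt.tendsto.mono_left nhdsWithin_le_nhds) h4

end GeneralizedDirichletSeries

/-! ### Periodic coefficients modulo 3. -/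

section PeriodicSequences

open Complex Filter Topology Set

/-- The only point in question is `s = 1` with `a = 0`, where the known residue of `riemannZeta`
makes `(s - 1) * riemannZeta s` extend analytically. -/
theorem meromorphic_expZeta (a : UnitAddCircle) : Meromorphic (HurwitzZeta.expZeta a) := by
  intro z
  by_cases h : z ≠ 1 ∨ a ≠ 0
  · have hU : {s : ℂ | s ≠ 1 ∨ a ≠ 0} ∈ 𝓝 z := by
      rcases h with h | h
      · exact Filter.mem_of_superset (isOpen_ne.mem_nhds h) fun s hs => Or.inl hs
      · exact Filter.univ_mem' fun s => Or.inr h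
    refine (Complex.analyticAt_iff_eventually_differentiableAt.2 ?_).meromorphicAt
    filter_upwards [hU] with s hs
    exact HurwitzZeta.differentiableAt_expZeta a s hs
  · push Not at h
    obtain ⟨rfl, rfl⟩ := h
    rw [HurwitzZeta.expZeta_zero]
    set u : ℂ → ℂ := Function.update (fun s => (s - 1) * riemannZeta s) 1 1 with hu
    have hne : ∀ s : ℂ, s ≠ 1 → u s = (s - 1) * riemannZeta s := fun s hs =>
      Function.update_of_ne hs _ _
    have hua : AnalyticAt ℂ u 1 := by
      refine Complex.analyticAt_of_differentiable_on_punctured_nhds_of_continuousAt ?_ ?_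
      · filter_upwards [self_mem_nhdsWithin] with s hs
        have h1 : DifferentiableAt ℂ (fun s => (s - 1) * riemannZeta s) s :=
          DifferentiableAt.fun_mul (by fun_prop) (differentiableAt_riemannZeta hs)
        refine h1.congr_of_eventuallyEq ?_
        filter_upwards [isOpen_ne.mem_nhds hs] with w hw using hne w hw
      · exact continuousAt_update_same.2 riemannZeta_residue_one
    refine (hua.meromorphicAt.fun_div (g := fun s => s - 1) (by fun_prop)).congr ?_
    filter_upwards [self_mem_nhdsWithin] with s hs
    rw [hne s hs, mul_div_cancel_left₀ _ (sub_ne_zero.2 hs)]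

theorem LSeriesContinues.exp (a : ℝ) :
    LSeriesContinues fun n => cexp (2 * Real.pi * I * a * n) := fun _ =>
  ⟨HurwitzZeta.expZeta a, (meromorphic_expZeta a).meromorphicOn, 1,
    fun _ hs => HurwitzZeta.LSeriesHasSum_exp a hs⟩

/-- The primitive third root of unity `e ^ (2 π i / 3)`. -/
noncomputable def root3 : ℂ := cexp (2 * Real.pi * I / 3)

theorem isPrimitiveRoot_root3 : IsPrimitiveRoot root3 3 :=
  Complex.isPrimitiveRoot_exp 3 (by norm_num)

theorem root3_pow_three : root3 ^ 3 = 1 := isPrimitiveRoot_root3.pow_eq_one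

theorem one_add_root3 : 1 + root3 + root3 ^ 2 = 0 := by
  have := isPrimitiveRoot_root3.geom_sum_eq_zero (by norm_num)
  simpa [Finset.sum_range_succ] using this

theorem root3_pow_mod (n : ℕ) : root3 ^ (n % 3) = root3 ^ n := by
  conv_rhs => rw [← Nat.div_add_mod n 3, pow_add, pow_mul, root3_pow_three, one_pow, one_mul]

theorem exp_mul_eq_root3_pow (a n : ℕ) :
    cexp (2 * Real.pi * I * ((a / 3 : ℝ) : ℂ) * n) = root3 ^ (a * n) := by
  rw [root3, ← Complex.exp_nat_mul]
  congr 1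
  push_cast
  ring

/-- Since `root3 ^ 3 = 1`, the factor 2 plays the role of `-1` and exponents stay natural numbers.
-/
theorem exp_neg_mul_eq_root3_pow (a n : ℕ) :
    cexp (2 * Real.pi * I * ((-(a / 3) : ℝ) : ℂ) * n) = root3 ^ (2 * a * n) := by
  have h1 : root3 ^ (2 * a * n) * root3 ^ (a * n) = 1 := by
    rw [← pow_add, show 2 * a * n + a * n = 3 * (a * n) by ring, pow_mul, root3_pow_three, one_pow]
  have h2 := exp_mul_eq_root3_pow a n
  have h3 : cexp (2 * Real.pi * I * ((-(a / 3) : ℝ) : ℂ) * n) *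
      cexp (2 * Real.pi * I * ((a / 3 : ℝ) : ℂ) * n) = 1 := by
    rw [← Complex.exp_add, ← Complex.exp_zero]
    congr 1
    push_cast
    ring
  rw [h2] at h3
  have h0 : root3 ^ (a * n) ≠ 0 := right_ne_zero_of_mul_eq_one h1
  exact mul_right_cancel₀ h0 (h3.trans h1.symm)

theorem sum_root3_pow (n : ℕ) : ∑ a ∈ Finset.range 3, root3 ^ (a * n) = if n % 3 = 0 then 3 else 0 := by
  have h1 : ∀ a, root3 ^ (a * n) = (root3 ^ (n % 3)) ^ a := fun a => by
    rw [root3_pow_mod, ← pow_mul, mul_comm]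
  simp only [h1, Finset.sum_range_succ, Finset.sum_range_zero, zero_add, pow_zero, pow_one]
  have h3 := root3_pow_three
  have h2 := one_add_root3
  have : n % 3 < 3 := Nat.mod_lt _ (by norm_num)
  interval_cases n % 3
  · norm_num
  · simpa using h2
  · simp only [OfNat.ofNat_ne_zero, if_false]
    linear_combination h2 + root3 * h3

/-- Orthogonality of the characters modulo 3; the factor `2 * c` stands for `-c`. -/
theorem LSeriesContinues.indicator_mod (c : ℕ) :
    LSeriesContinues fun n => if n % 3 = c % 3 then 1 else 0 := by
  refine (LSeriesContinues.sum (Finset.range 3) fun a _ =>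
    (LSeriesContinues.exp ((a : ℕ) / 3 : ℝ)).smul (root3 ^ (a * (2 * c)) / 3)).congr fun n _ => ?_
  simp only [Finset.sum_apply, Pi.smul_apply, smul_eq_mul, exp_mul_eq_root3_pow, div_mul_eq_mul_div,
    ← pow_add, ← mul_add, ← Finset.sum_div]
  rw [sum_root3_pow]
  by_cases h : n % 3 = c % 3
  · rw [if_pos h, if_pos (by omega)]
    norm_num
  · rw [if_neg h, if_neg (by omega), zero_div]

theorem LSeriesContinues.of_periodic {u : ℕ → ℂ} (hu : ∀ n, u n = u (n % 3)) :
    LSeriesContinues u := by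
  refine (LSeriesContinues.sum (Finset.range 3) fun c _ =>
    (LSeriesContinues.indicator_mod c).smul (u c)).congr fun n _ => ?_
  simp only [Finset.sum_apply, Pi.smul_apply, smul_eq_mul, Finset.sum_range_succ,
    Finset.sum_range_zero, zero_add]
  rw [hu n]
  have : n % 3 < 3 := Nat.mod_lt _ (by norm_num)
  interval_cases n % 3 <;> simp

end PeriodicSequences

/-! ### Partial power sums over a residue class. -/

section PartialSums

open Complex Filter Topology Set

/-- The sum of `1 / m ^ j` over `m ≤ n` with `m ≡ 2 n (mod 3)`. -/
noncomputable def powerSum (j n : ℕ) : ℂ :=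
  ∑ m ∈ Finset.range (n + 1), if m % 3 = 2 * n % 3 then 1 / (m : ℂ) ^ j else 0

/-- The representative of `n` modulo `3` in `{1, 2, 3}`. -/
def res3 (n : ℕ) : ℕ := (n + 2) % 3 + 1

theorem res3_add_three (n : ℕ) : res3 (n + 3) = res3 n := by
  simp only [res3]
  omega

/-- The class of `2 * n` is unchanged under `n ↦ n + 3`, and exactly one of `n + 1, n + 2, n + 3`
lies in it, namely `n + res3 n`. -/
theorem powerSum_add_three (j n : ℕ) :
    powerSum j (n + 3) = powerSum j n + 1 / ((n + res3 n : ℕ) : ℂ) ^ j := by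
  have h1 : ∀ m, m % 3 = 2 * (n + 3) % 3 ↔ m % 3 = 2 * n % 3 := fun m => by omega
  simp only [powerSum, h1, Finset.sum_range_succ _ (n + 3), Finset.sum_range_succ _ (n + 2),
    Finset.sum_range_succ _ (n + 1)]
  have h2 : n % 3 = 0 ∨ n % 3 = 1 ∨ n % 3 = 2 := by omega
  rcases h2 with h2 | h2 | h2
  · rw [if_neg (by omega : ¬(n + 1) % 3 = _), if_neg (by omega : ¬(n + 2) % 3 = _),
      if_pos (by omega : (n + 3) % 3 = _), show res3 n = 3 by simp only [res3]; omega]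
    ring
  · rw [if_neg (by omega : ¬(n + 3) % 3 = _), if_neg (by omega : ¬(n + 2) % 3 = _),
      if_pos (by omega : (n + 1) % 3 = _), show res3 n = 1 by simp only [res3]; omega]
    ring
  · rw [if_neg (by omega : ¬(n + 3) % 3 = _), if_neg (by omega : ¬(n + 1) % 3 = _),
      if_pos (by omega : (n + 2) % 3 = _), show res3 n = 2 by simp only [res3]; omega]
    ring

theorem powerSum_zero {j : ℕ} (hj : j ≠ 0) : powerSum j 0 = 0 := by simp [powerSum, hj]

theorem powerSum_one {j : ℕ} : powerSum j 1 = 0 := by simp [powerSum, Finset.sum_range_succ]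

theorem powerSum_two {j : ℕ} : powerSum j 2 = 1 := by simp [powerSum, Finset.sum_range_succ]

theorem norm_powerSum_le (j : ℕ) {n : ℕ} (hn : n ≠ 0) : ‖powerSum j n‖ ≤ 2 * n := by
  have h1 : ∀ m : ℕ, ‖(if m % 3 = 2 * n % 3 then 1 / (m : ℂ) ^ j else 0)‖ ≤ 1 := by
    intro m
    split_ifs
    · rw [norm_div, norm_one, norm_pow, norm_natCast]
      rcases eq_or_ne m 0 with rfl | hm
      · rcases eq_or_ne j 0 with rfl | hj
        · simp
        · simp [hj]
      · have : (1 : ℝ) ≤ m := by exact_mod_cast Nat.one_le_iff_ne_zero.2 hm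
        exact div_le_one_of_le₀ (one_le_pow₀ this) (by positivity)
    · simp
  have h2 := norm_sum_le_of_le (Finset.range (n + 1)) fun m _ => h1 m
  have h3 : (1 : ℝ) ≤ n := by exact_mod_cast Nat.one_le_iff_ne_zero.2 hn
  refine h2.trans ?_
  simp
  linarith

/-- The third difference in index, `a n - a (n - 3)`, is `1 / n ^ j`, `1 / (n - 1) ^ j` or `1 / (n -
2) ^ j` according as `n ≡ 0, 1, 2 (mod 3)`: a sum of shifts of sequences already continued. -/
theorem LSeriesContinues.powerSum {j : ℕ} (hj : j ≠ 0) : LSeriesContinues (powerSum j) := by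
  refine LSeriesContinues.of_sub_rshift (h := 3) (c := 3) (by norm_num) ?_ ?_
  · refine LSeriesSummable_of_le_const_mul_rpow (x := 2) (by simp; norm_num) ⟨2, fun n hn => ?_⟩
    norm_num
    exact norm_powerSum_le j hn
  · refine (((LSeriesContinues.indicator_mod 0).div_pow j).add
      ((((LSeriesContinues.indicator_mod 1).div_pow j).rshift 1).add
      (((LSeriesContinues.indicator_mod 2).div_pow j).rshift 2))).congr fun n hn => ?_
    simp only [Pi.add_apply, Pi.sub_apply, _root_.rshift]
    by_cases h3 : 3 < n
    · obtain ⟨m, rfl⟩ : ∃ m, n = m + 3 := ⟨n - 3, by omega⟩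
      rw [if_pos (show 1 < m + 3 by omega), if_pos (show 2 < m + 3 by omega), if_pos h3,
        Nat.add_sub_cancel, powerSum_add_three, add_sub_cancel_left,
        show m + 3 - 1 = m + 2 by omega, show m + 3 - 2 = m + 1 by omega]
      have h2 : m % 3 = 0 ∨ m % 3 = 1 ∨ m % 3 = 2 := by omega
      rcases h2 with h2 | h2 | h2
      · rw [if_pos (show (m + 3) % 3 = 0 % 3 by omega), if_neg (show ¬(m + 2) % 3 = 1 % 3 by omega),
          if_neg (show ¬(m + 1) % 3 = 2 % 3 by omega), show res3 m = 3 by simp only [res3]; omega]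
        simp
      · rw [if_neg (show ¬(m + 3) % 3 = 0 % 3 by omega),
          if_neg (show ¬(m + 2) % 3 = 1 % 3 by omega),
          if_pos (show (m + 1) % 3 = 2 % 3 by omega), show res3 m = 1 by simp only [res3]; omega]
        simp
      · rw [if_neg (show ¬(m + 3) % 3 = 0 % 3 by omega), if_pos (show (m + 2) % 3 = 1 % 3 by omega),
          if_neg (show ¬(m + 1) % 3 = 2 % 3 by omega), show res3 m = 2 by simp only [res3]; omega]
        simp
    · have : n = 1 ∨ n = 2 ∨ n = 3 := by omega
      rcases this with rfl | rfl | rfl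
      · simp [powerSum_one]
      · simp [powerSum_two]
      · rw [show 3 = 0 + 3 from rfl, powerSum_add_three, powerSum_zero hj]
        simp [res3]

end PartialSums

/-! ### Coefficients of the series in `(m + n) ^ (-s)`. -/

section ConvolutionSums

open Complex Filter Topology Set

/-- The sum of `1 / (m ^ p * n ^ q)` over `m, n ≥ 1` with `m + n = N` and `m ≡ n (mod 3)`. -/
noncomputable def convSum (p q N : ℕ) : ℂ :=
  ∑ x ∈ Finset.HasAntidiagonal.antidiagonal N, if x.1 ≠ 0 ∧ x.2 ≠ 0 ∧ x.1 ≡ x.2 [MOD 3] then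
    1 / ((x.1 : ℂ) ^ p * (x.2 : ℂ) ^ q) else 0

theorem convSum_comm (p q N : ℕ) : convSum p q N = convSum q p N := by
  rw [convSum, ← Finset.Nat.sum_antidiagonal_swap]
  refine Finset.sum_congr rfl fun x _ => ?_
  simp only [Prod.fst_swap, Prod.snd_swap]
  refine if_congr ?_ (by rw [mul_comm]) rfl
  exact ⟨fun h => ⟨h.2.1, h.1, h.2.2.symm⟩, fun h => ⟨h.2.1, h.1, h.2.2.symm⟩⟩

/-- Partial fractions: `N / (x * y) = 1 / x + 1 / y` when `x + y = N`. -/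
theorem natCast_mul_convSum (p q N : ℕ) :
    N * convSum (p + 1) (q + 1) N = convSum p (q + 1) N + convSum (p + 1) q N := by
  rw [convSum, convSum, convSum, Finset.mul_sum, ← Finset.sum_add_distrib]
  refine Finset.sum_congr rfl fun x hx => ?_
  rw [Finset.HasAntidiagonal.mem_antidiagonal] at hx
  split_ifs with h
  · have h1 : (x.1 : ℂ) ≠ 0 := by exact_mod_cast h.1
    have h2 : (x.2 : ℂ) ≠ 0 := by exact_mod_cast h.2.1
    rw [← hx]
    push_cast
    field_simp
    ring
  · simp

/-- The condition `m ≡ N - m` reads `m ≡ 2 * N`; the subtracted term is the endpoint `m = N`, which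
only `powerSum` includes. -/
theorem convSum_zero_right {p : ℕ} (hp : p ≠ 0) (N : ℕ) :
    convSum p 0 N = powerSum p N - if N % 3 = 0 then 1 / (N : ℂ) ^ p else 0 := by
  have h0 : (N % 3 = 2 * N % 3) = (N % 3 = 0) := by
    apply propext
    omega
  rw [convSum, powerSum, Finset.Nat.sum_antidiagonal_eq_sum_range_succ
    (f := fun a b : ℕ => if a ≠ 0 ∧ b ≠ 0 ∧ a ≡ b [MOD 3] then
    1 / ((a : ℂ) ^ p * (b : ℂ) ^ 0) else 0), Finset.sum_range_succ, Finset.sum_range_succ]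
  simp only [h0, Nat.sub_self, ne_eq, not_true_eq_false, false_and, and_false, if_false, add_zero,
    add_sub_cancel_right, pow_zero, mul_one]
  refine Finset.sum_congr rfl fun m hm => ?_
  rw [Finset.mem_range] at hm
  rcases eq_or_ne m 0 with rfl | hm0
  · simp [hp]
  · refine if_congr ?_ rfl rfl
    rw [Nat.ModEq]
    omega

theorem LSeriesContinues.indicator_div_pow (p : ℕ) :
    LSeriesContinues fun N => if N % 3 = 0 then 1 / (N : ℂ) ^ p else 0 :=
  ((LSeriesContinues.indicator_mod 0).div_pow p).congr fun n _ => by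
    rw [ite_div, zero_div, Nat.zero_mod]

theorem LSeriesContinues.convSum_zero {p : ℕ} (hp : p ≠ 0) : LSeriesContinues (convSum p 0) :=
  ((LSeriesContinues.powerSum hp).sub (.indicator_div_pow p)).congr fun n _ =>
    (convSum_zero_right hp n).symm

theorem LSeriesContinues.convSum : ∀ p q : ℕ, p + q ≠ 0 → LSeriesContinues (convSum p q)
  | 0, q, hpq =>
    (LSeriesContinues.convSum_zero (p := q) (by omega)).congr fun n _ => convSum_comm _ _ _
  | p + 1, 0, hpq => .convSum_zero hpq
  | p + 1, q + 1, _ => by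
    refine (((LSeriesContinues.convSum p (q + 1) (by omega)).add
      (LSeriesContinues.convSum (p + 1) q (by omega))).div_pow 1).congr fun n hn => ?_
    have h0 : (n : ℂ) ≠ 0 := by exact_mod_cast hn
    rw [pow_one, div_eq_iff h0, Pi.add_apply, ← natCast_mul_convSum, mul_comm]
termination_by p q => p + q

end ConvolutionSums

/-! ### Coefficients of the series in `n ^ (-s)`. -/

section TailSums

open Complex Filter Topology Set

/-- The sum of `1 / (m ^ p * (m + n) ^ q)` over `m ≥ 1` with `m ≡ n (mod 3)`. -/
noncomputable def tailSum (p q n : ℕ) : ℂ :=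
  ∑' k : ℕ, 1 / (((res3 n + 3 * k : ℕ) : ℂ) ^ p * ((res3 n + 3 * k + n : ℕ) : ℂ) ^ q)

theorem res3_pos (n : ℕ) : 1 ≤ res3 n := by simp [res3]

theorem norm_one_div_pow_mul_pow_le {p q r k n : ℕ} (hpq : 2 ≤ p + q) (hr : 1 ≤ r) :
    ‖1 / (((r + 3 * k : ℕ) : ℂ) ^ p * ((r + 3 * k + n : ℕ) : ℂ) ^ q)‖ ≤
      1 / ((k + 1 : ℕ) : ℝ) ^ 2 := by
  rw [norm_div, norm_mul, norm_pow, norm_pow, norm_natCast, norm_natCast, norm_one]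
  have h1 : ((k + 1 : ℕ) : ℝ) ≤ ((r + 3 * k : ℕ) : ℝ) := by exact_mod_cast (by omega)
  have h2 : ((k + 1 : ℕ) : ℝ) ≤ ((r + 3 * k + n : ℕ) : ℝ) := by exact_mod_cast (by omega)
  have h3 : (1 : ℝ) ≤ ((k + 1 : ℕ) : ℝ) := by exact_mod_cast (by omega)
  refine one_div_le_one_div_of_le (by positivity) ?_
  calc ((k + 1 : ℕ) : ℝ) ^ 2 ≤ ((k + 1 : ℕ) : ℝ) ^ (p + q) := pow_le_pow_right₀ h3 hpq
    _ = ((k + 1 : ℕ) : ℝ) ^ p * ((k + 1 : ℕ) : ℝ) ^ q := pow_add _ _ _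
    _ ≤ _ := by gcongr

theorem summable_one_div_pow_mul_pow {p q r : ℕ} (n : ℕ) (hpq : 2 ≤ p + q) (hr : 1 ≤ r) :
    Summable fun k : ℕ => 1 / (((r + 3 * k : ℕ) : ℂ) ^ p * ((r + 3 * k + n : ℕ) : ℂ) ^ q) :=
  Summable.of_norm_bounded
    ((summable_nat_add_iff (f := fun k : ℕ => 1 / (k : ℝ) ^ 2) 1).2
      (Real.summable_one_div_nat_pow.2 one_lt_two))
    fun _ => norm_one_div_pow_mul_pow_le hpq hr

/-- Partial fractions from `n = (m + n) - m`; `hpq` makes the two resulting series converge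
separately. -/
theorem natCast_mul_tailSum {p q : ℕ} (hpq : 1 ≤ p + q) (n : ℕ) :
    n * tailSum (p + 1) (q + 1) n = tailSum (p + 1) q n - tailSum p (q + 1) n := by
  have hr := res3_pos n
  rw [tailSum, tailSum, tailSum, ← tsum_mul_left,
    ← (summable_one_div_pow_mul_pow n (by omega) hr).tsum_sub
      (summable_one_div_pow_mul_pow n (by omega) hr)]
  refine tsum_congr fun k => ?_
  have h1 : ((res3 n + 3 * k : ℕ) : ℂ) ≠ 0 := by exact_mod_cast (by omega)
  have h2 : ((res3 n + 3 * k + n : ℕ) : ℂ) ≠ 0 := by exact_mod_cast (by omega)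
  have h3 : (n : ℂ) = ((res3 n + 3 * k + n : ℕ) : ℂ) - ((res3 n + 3 * k : ℕ) : ℂ) := by
    push_cast
    ring
  generalize ((res3 n + 3 * k + n : ℕ) : ℂ) = y at *
  generalize ((res3 n + 3 * k : ℕ) : ℂ) = x at *
  rw [h3]
  field_simp
  ring

theorem tailSum_zero_right_congr (p : ℕ) {m n : ℕ} (h : m % 3 = n % 3) :
    tailSum p 0 m = tailSum p 0 n := by
  have h1 : res3 m = res3 n := by
    simp only [res3]
    omega
  simp only [tailSum, h1, pow_zero]

theorem tailSum_zero_left_add_three {q : ℕ} (hq : 2 ≤ q) (n : ℕ) :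
    tailSum 0 q n = 1 / ((n + res3 n : ℕ) : ℂ) ^ q + tailSum 0 q (n + 3) := by
  have hs := summable_one_div_pow_mul_pow (p := 0) n (by omega : 2 ≤ 0 + q) (res3_pos n)
  rw [tailSum, hs.tsum_eq_zero_add, tailSum, res3_add_three]
  congr 1
  · simp [add_comm]
  · refine tsum_congr fun k => ?_
    rw [pow_zero, pow_zero, show res3 n + 3 * (k + 1) + n = res3 n + 3 * k + (n + 3) by ring]

/-- The tail runs over the numbers above `n` in the class of `2 * n`, the partial sum over those up
to `n`. Passing from `n` to `n + 3` moves one term between them, so three initial cases suffice. -/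
theorem tailSum_zero_left_add_powerSum {q : ℕ} (hq : 2 ≤ q) (n : ℕ) :
    tailSum 0 q n + powerSum q n = tailSum q 0 (2 * n) := by
  have h3 : ∀ n, tailSum 0 q n + powerSum q n = tailSum q 0 (2 * n) →
      tailSum 0 q (n + 3) + powerSum q (n + 3) = tailSum q 0 (2 * (n + 3)) := by
    intro n h
    rw [tailSum_zero_right_congr q (by omega : 2 * (n + 3) % 3 = 2 * n % 3), ← h,
      tailSum_zero_left_add_three hq n, powerSum_add_three]
    ring
  induction n using Nat.strong_induction_on with
  | _ n ih =>
    rcases lt_or_ge n 3 with hn | hn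
    · interval_cases n
      · rw [powerSum_zero (by omega)]
        simp [tailSum, res3]
      · rw [powerSum_one]
        simp only [tailSum, res3, pow_zero, one_mul, mul_one, add_zero]
        refine tsum_congr fun k => ?_
        congr 3
        omega
      · have hs := summable_one_div_pow_mul_pow (p := q) (r := 1) 0 (by omega : 2 ≤ q + 0) le_rfl
        rw [powerSum_two]
        simp only [tailSum, res3, pow_zero, one_mul, mul_one] at hs ⊢
        norm_num only
        rw [hs.tsum_eq_zero_add, add_comm]
        congr 1
        · simp
        · refine tsum_congr fun k => ?_
          congr 3
          omega
    · obtain ⟨m, rfl⟩ : ∃ m, n = m + 3 := ⟨n - 3, by omega⟩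
      exact h3 m (ih m (by omega))

theorem natCast_mul_tailSum_one_one (n : ℕ) :
    HasSum (fun k : ℕ => 1 / ((res3 n + 3 * k : ℕ) : ℂ) - 1 / ((res3 n + 3 * k + n : ℕ) : ℂ))
      (n * tailSum 1 1 n) := by
  refine ((summable_one_div_pow_mul_pow (p := 1) (q := 1) n le_rfl
    (res3_pos n)).hasSum.mul_left (n : ℂ)).congr_fun fun k => ?_
  have hr := res3_pos n
  have h1 : ((res3 n + 3 * k : ℕ) : ℂ) ≠ 0 := by exact_mod_cast (by omega)
  have h2 : ((res3 n + 3 * k + n : ℕ) : ℂ) ≠ 0 := by exact_mod_cast (by omega)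
  have h3 : (n : ℂ) = ((res3 n + 3 * k + n : ℕ) : ℂ) - ((res3 n + 3 * k : ℕ) : ℂ) := by
    push_cast
    ring
  generalize ((res3 n + 3 * k + n : ℕ) : ℂ) = y at *
  generalize ((res3 n + 3 * k : ℕ) : ℂ) = x at *
  rw [h3]
  field_simp

/-- The difference of the two series telescopes, since `res3` is unchanged and `1 / (m + n)` moves
by one index. -/
theorem natCast_mul_tailSum_one_one_add_three (n : ℕ) :
    ((n + 3 : ℕ) : ℂ) * tailSum 1 1 (n + 3) = n * tailSum 1 1 n + 1 / ((n + res3 n : ℕ) : ℂ) := by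
  have h := (natCast_mul_tailSum_one_one (n + 3)).sub (natCast_mul_tailSum_one_one n)
  have h1 := h.tendsto_sum_nat
  set u : ℕ → ℂ := fun k => 1 / ((n + res3 n + 3 * k : ℕ) : ℂ) with hu
  have h2 : ∀ K, ∑ k ∈ Finset.range K,
      ((1 / ((res3 (n + 3) + 3 * k : ℕ) : ℂ) - 1 / ((res3 (n + 3) + 3 * k + (n + 3) : ℕ) : ℂ)) -
      (1 / ((res3 n + 3 * k : ℕ) : ℂ) - 1 / ((res3 n + 3 * k + n : ℕ) : ℂ))) = u 0 - u K := by
    intro K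
    rw [← Finset.sum_range_sub']
    refine Finset.sum_congr rfl fun k _ => ?_
    rw [res3_add_three, hu]
    simp only
    rw [show n + res3 n + 3 * (k + 1) = res3 n + 3 * k + (n + 3) by ring,
      show n + res3 n + 3 * k = res3 n + 3 * k + n by ring]
    ring
  simp only [h2] at h1
  have h3 : Tendsto u atTop (𝓝 0) := by
    have h4 : Tendsto (fun k : ℕ => n + res3 n + 3 * k) atTop atTop :=
      tendsto_atTop_mono (fun k => by omega : ∀ k, k ≤ n + res3 n + 3 * k) tendsto_id
    exact (tendsto_one_div_atTop_nhds_zero_nat (𝕜 := ℂ)).comp h4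
  have h5 := tendsto_nhds_unique h1 (tendsto_const_nhds.sub h3)
  rw [sub_zero, hu] at h5
  simp only [mul_zero, add_zero] at h5
  rw [← h5]
  ring

/-- The value of `∑ 1 / x` over the nonzero integers `x ≡ 2 n (mod 3)`, summed symmetrically. -/
noncomputable def reciprocalSum (n : ℕ) : ℂ :=
  Real.pi * I / 9 * (root3 ^ n - root3 ^ (2 * n))

theorem pi_mul_cot_third : Real.pi * cot (Real.pi * (1 / 3)) =
    -(Real.pi * I / 3 * (root3 - root3 ^ 2)) := by
  have h1 : cexp (2 * I * (Real.pi * (1 / 3))) = root3 := by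
    rw [root3]
    congr 1
    ring
  have h2 : 1 - root3 ≠ 0 := sub_ne_zero.2 (isPrimitiveRoot_root3.ne_one (by norm_num)).symm
  rw [Complex.cot_eq_exp_ratio, h1]
  rw [mul_div_assoc', div_eq_iff (mul_ne_zero I_ne_zero h2)]
  have h3 := one_add_root3
  linear_combination (Real.pi / 3 : ℂ) * (root3 * (1 - root3) ^ 2) * I_sq +
    (Real.pi : ℂ) * (1 - root3 / 3) * h3

theorem pi_mul_cot_two_thirds : Real.pi * cot (Real.pi * (2 / 3)) =
    Real.pi * I / 3 * (root3 - root3 ^ 2) := by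
  have h1 : cexp (2 * I * (Real.pi * (2 / 3))) = root3 ^ 2 := by
    rw [root3, ← Complex.exp_nat_mul]
    congr 1
    push_cast
    ring
  have h2 : 1 - root3 ^ 2 ≠ 0 :=
    sub_ne_zero.2 (isPrimitiveRoot_root3.pow_ne_one_of_pos_of_lt (by norm_num) (by norm_num)).symm
  rw [Complex.cot_eq_exp_ratio, h1]
  rw [mul_div_assoc', div_eq_iff (mul_ne_zero I_ne_zero h2)]
  have h3 := one_add_root3
  have h4 := root3_pow_three
  linear_combination (-(Real.pi / 3 : ℂ)) * (root3 - root3 ^ 2) * (1 - root3 ^ 2) * I_sq +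
    (2 * Real.pi / 3 : ℂ) * h3 + (Real.pi / 3 : ℂ) * (root3 - 1) * h4

theorem div_three_mem_integerComplement {a : ℕ} (ha : a % 3 ≠ 0) :
    (a / 3 : ℂ) ∈ integerComplement := by
  rintro ⟨n, hn⟩
  have h1 : (3 * n : ℂ) = a := by
    rw [hn]
    ring
  have h2 : 3 * n = (a : ℤ) := by exact_mod_cast h1
  omega

/-- The Mittag-Leffler expansion of the cotangent at `a / 3`. -/
theorem hasSum_cot_third (a : ℕ) (ha : a % 3 ≠ 0) :
    HasSum (fun k : ℕ => 1 / ((a : ℂ) / 3 - (k + 1)) + 1 / ((a : ℂ) / 3 + (k + 1)))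
      (Real.pi * cot (Real.pi * (a / 3)) - 3 / a) := by
  have h := div_three_mem_integerComplement ha
  have h1 := (summable_cotTerm h).hasSum
  have h2 := cot_series_rep' h
  simp only [cotTerm] at h1
  rw [← h2] at h1
  convert h1 using 2
  rw [one_div_div]

theorem two_mul_tailSum_one_one_two :
    ((2 : ℕ) : ℂ) * tailSum 1 1 2 = powerSum 1 2 - reciprocalSum 2 := by
  have h1 := natCast_mul_tailSum_one_one 2
  have h2 := (hasSum_cot_third 1 (by norm_num)).mul_left (-1 / 3)
  have h3 : ∀ k : ℕ, 1 / ((res3 2 + 3 * k : ℕ) : ℂ) - 1 / ((res3 2 + 3 * k + 2 : ℕ) : ℂ) =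
      -1 / 3 * (1 / (((1 : ℕ) : ℂ) / 3 - (k + 1)) + 1 / (((1 : ℕ) : ℂ) / 3 + (k + 1))) := by
    intro k
    have e1 : ((1 : ℕ) : ℂ) / 3 - (k + 1) = -((2 + 3 * k : ℕ) : ℂ) / 3 := by push_cast; ring
    have e2 : ((1 : ℕ) : ℂ) / 3 + (k + 1) = ((2 + 3 * k + 2 : ℕ) : ℂ) / 3 := by push_cast; ring
    have n1 : ((2 + 3 * k : ℕ) : ℂ) ≠ 0 := Nat.cast_ne_zero.2 (by omega)
    have n2 : ((2 + 3 * k + 2 : ℕ) : ℂ) ≠ 0 := Nat.cast_ne_zero.2 (by omega)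
    rw [e1, e2, show res3 2 = 2 from rfl]
    generalize ((2 + 3 * k : ℕ) : ℂ) = x at *
    generalize ((2 + 3 * k + 2 : ℕ) : ℂ) = y at *
    field_simp
    ring
  simp only [h3] at h1
  rw [h1.unique h2, powerSum_two, reciprocalSum, Nat.cast_one, pi_mul_cot_third]
  have h4 : root3 ^ (2 * 2) = root3 := by
    linear_combination root3 * root3_pow_three
  rw [h4]
  ring

/-- For `n = 4` the pairs `1 + 3k`, `5 + 3k` match the cotangent terms at `2 / 3` index by index;
for `n = 1` they would be offset by one. The case `n = 1` is recovered from this one by the step-3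
recursion. -/
theorem four_mul_tailSum_one_one_four :
    ((4 : ℕ) : ℂ) * tailSum 1 1 4 = powerSum 1 4 - reciprocalSum 4 := by
  have h1 := natCast_mul_tailSum_one_one 4
  have h2 := (hasSum_cot_third 2 (by norm_num)).mul_left (-1 / 3)
  have h3 : ∀ k : ℕ, 1 / ((res3 4 + 3 * k : ℕ) : ℂ) - 1 / ((res3 4 + 3 * k + 4 : ℕ) : ℂ) =
      -1 / 3 * (1 / (((2 : ℕ) : ℂ) / 3 - (k + 1)) + 1 / (((2 : ℕ) : ℂ) / 3 + (k + 1))) := by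
    intro k
    have e1 : ((2 : ℕ) : ℂ) / 3 - (k + 1) = -((1 + 3 * k : ℕ) : ℂ) / 3 := by push_cast; ring
    have e2 : ((2 : ℕ) : ℂ) / 3 + (k + 1) = ((1 + 3 * k + 4 : ℕ) : ℂ) / 3 := by push_cast; ring
    have n1 : ((1 + 3 * k : ℕ) : ℂ) ≠ 0 := Nat.cast_ne_zero.2 (by omega)
    have n2 : ((1 + 3 * k + 4 : ℕ) : ℂ) ≠ 0 := Nat.cast_ne_zero.2 (by omega)
    rw [e1, e2, show res3 4 = 1 from rfl]
    generalize ((1 + 3 * k : ℕ) : ℂ) = x at *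
    generalize ((1 + 3 * k + 4 : ℕ) : ℂ) = y at *
    field_simp
    ring
  simp only [h3] at h1
  rw [h1.unique h2, show 4 = 1 + 3 from rfl, powerSum_add_three, powerSum_one, reciprocalSum,
    Nat.cast_two, pi_mul_cot_two_thirds, show res3 1 = 1 from rfl]
  have h4 : root3 ^ (1 + 3) = root3 := by
    linear_combination root3 * root3_pow_three
  have h5 : root3 ^ (2 * (1 + 3)) = root3 ^ 2 := by
    linear_combination root3 ^ 2 * (root3 ^ 3 + 1) * root3_pow_three
  rw [h4, h5]
  push_cast
  ring

theorem reciprocalSum_mod (n : ℕ) : reciprocalSum (n % 3) = reciprocalSum n := by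
  simp only [reciprocalSum, root3_pow_mod, pow_mul', root3_pow_mod]

theorem reciprocalSum_add_three (n : ℕ) : reciprocalSum (n + 3) = reciprocalSum n := by
  rw [← reciprocalSum_mod, Nat.add_mod_right, reciprocalSum_mod]

theorem natCast_mul_tailSum_one_one_eq (n : ℕ) :
    n * tailSum 1 1 n = powerSum 1 n - reciprocalSum n := by
  induction n using Nat.strong_induction_on with
  | _ n ih =>
    rcases lt_or_ge n 3 with hn | hn
    · interval_cases n
      · simp [powerSum_zero, reciprocalSum]
      · have h1 := four_mul_tailSum_one_one_four
        rw [show 4 = 1 + 3 from rfl, natCast_mul_tailSum_one_one_add_three, powerSum_add_three,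
          reciprocalSum_add_three, pow_one] at h1
        linear_combination h1
      · exact two_mul_tailSum_one_one_two
    · obtain ⟨m, rfl⟩ : ∃ m, n = m + 3 := ⟨n - 3, by omega⟩
      rw [natCast_mul_tailSum_one_one_add_three, powerSum_add_three, reciprocalSum_add_three,
        ih m (by omega), pow_one]
      ring

theorem LSeriesContinues.tailSum_zero_right (p : ℕ) : LSeriesContinues (tailSum p 0) :=
  .of_periodic fun n => tailSum_zero_right_congr p (Nat.mod_mod n 3).symm

theorem LSeriesContinues.tailSum_zero_left {q : ℕ} (hq : 2 ≤ q) :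
    LSeriesContinues (tailSum 0 q) := by
  have h1 : LSeriesContinues fun n => tailSum q 0 (2 * n) :=
    .of_periodic fun n => tailSum_zero_right_congr q (by omega)
  refine (h1.sub (.powerSum (j := q) (by omega))).congr fun n _ => ?_
  rw [Pi.sub_apply, ← tailSum_zero_left_add_powerSum hq, add_sub_cancel_right]

theorem LSeriesContinues.tailSum_one_one : LSeriesContinues (tailSum 1 1) := by
  have h1 : LSeriesContinues reciprocalSum := .of_periodic fun n => (reciprocalSum_mod n).symm
  refine (((LSeriesContinues.powerSum one_ne_zero).sub h1).div_pow 1).congr fun n hn => ?_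
  have h0 : (n : ℂ) ≠ 0 := by exact_mod_cast hn
  rw [pow_one, div_eq_iff h0, Pi.sub_apply, ← natCast_mul_tailSum_one_one_eq, mul_comm]

/-- Induction on `p + q` by partial fractions. The pair `(1, 1)` is separate because there the two
fractions diverge individually. -/
theorem LSeriesContinues.tailSum : ∀ p q : ℕ, 2 ≤ p + q → LSeriesContinues (tailSum p q)
  | 0, q, hpq => .tailSum_zero_left (by omega)
  | p, 0, _ => .tailSum_zero_right p
  | p + 1, q + 1, _ => by
    rcases Nat.eq_zero_or_pos (p + q) with h | h
    · obtain ⟨rfl, rfl⟩ : p = 0 ∧ q = 0 := by omega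
      exact .tailSum_one_one
    · refine (((LSeriesContinues.tailSum (p + 1) q (by omega)).sub
        (LSeriesContinues.tailSum p (q + 1) (by omega))).div_pow 1).congr fun n hn => ?_
      have h0 : (n : ℂ) ≠ 0 := by exact_mod_cast hn
      rw [pow_one, div_eq_iff h0, Pi.sub_apply, ← natCast_mul_tailSum h, mul_comm]
termination_by p q => p + q

end TailSums

/-! ### The double series as Dirichlet series. -/

section DoubleSeries

open Complex Filter Topology Set

/-- The pair of natural numbers underlying an index. -/
def PU3Index.toProd (x : PU3Index) : ℕ × ℕ := ((x.1.1 : ℕ), (x.1.2 : ℕ))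

theorem PU3Index.toProd_injective : Function.Injective PU3Index.toProd := by
  rintro ⟨⟨a, b⟩, h⟩ ⟨⟨c, d⟩, h'⟩ hx
  simp only [PU3Index.toProd, Prod.mk.injEq] at hx
  have h1 : a = c := PNat.coe_injective hx.1
  have h2 : b = d := PNat.coe_injective hx.2
  subst h1 h2
  rfl

theorem PU3Index.mem_range_toProd {y : ℕ × ℕ} :
    y ∈ range PU3Index.toProd ↔ y.1 ≠ 0 ∧ y.2 ≠ 0 ∧ y.1 ≡ y.2 [MOD 3] := by
  constructor
  · rintro ⟨x, rfl⟩
    exact ⟨x.1.1.ne_zero, x.1.2.ne_zero, x.2⟩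
  · rintro ⟨h1, h2, h3⟩
    exact ⟨⟨(⟨y.1, Nat.pos_of_ne_zero h1⟩, ⟨y.2, Nat.pos_of_ne_zero h2⟩), h3⟩, rfl⟩

theorem hasSum_PU3Index_iff {F : ℕ × ℕ → ℂ} {S : ℂ} :
    HasSum (fun x : PU3Index => F x.toProd) S ↔
      HasSum (fun y : ℕ × ℕ => if y.1 ≠ 0 ∧ y.2 ≠ 0 ∧ y.1 ≡ y.2 [MOD 3] then F y else 0) S := by
  rw [← PU3Index.toProd_injective.hasSum_iff (f := fun y : ℕ × ℕ =>
    if y.1 ≠ 0 ∧ y.2 ≠ 0 ∧ y.1 ≡ y.2 [MOD 3] then F y else 0)]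
  · refine iff_of_eq (congrArg (fun f => HasSum f S _) (funext fun x => ?_))
    exact (if_pos (PU3Index.mem_range_toProd.1 ⟨x, rfl⟩)).symm
  · intro y hy
    exact if_neg fun h => hy (PU3Index.mem_range_toProd.2 h)

theorem zetaPU3Term_natCast_natCast (p q : ℕ) (s : ℂ) :
    zetaPU3Term p q s = fun x => 1 / ((x.toProd.1 : ℂ) ^ p * (x.toProd.2 : ℂ) ^ q) /
      ((x.toProd.1 + x.toProd.2 : ℕ) : ℂ) ^ s := by
  funext x
  simp only [zetaPU3Term, PU3Index.toProd, cpow_natCast, Nat.cast_add, div_div]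

theorem zetaPU3Term_natCast_self_natCast (p q : ℕ) (s : ℂ) :
    zetaPU3Term p s q = fun x => 1 / ((x.toProd.1 : ℂ) ^ p * ((x.toProd.1 + x.toProd.2 : ℕ) : ℂ) ^ q) /
      (x.toProd.2 : ℂ) ^ s := by
  funext x
  simp only [zetaPU3Term, PU3Index.toProd, cpow_natCast, Nat.cast_add, div_div]
  congr 1
  ring

theorem summable_PU3Index_of_le {f : PU3Index → ℂ} {a b : ℝ} (ha : 1 < a) (hb : 1 < b)
    (h : ∀ x, ‖f x‖ ≤ 1 / (x.toProd.1 : ℝ) ^ a * (1 / (x.toProd.2 : ℝ) ^ b)) : Summable f := by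
  have h1 := (Real.summable_one_div_nat_rpow.2 ha).mul_of_nonneg
    (Real.summable_one_div_nat_rpow.2 hb) (fun n => by positivity) (fun n => by positivity)
  exact Summable.of_norm_bounded (h1.comp_injective PU3Index.toProd_injective) h

theorem PU3Index.one_le (x : PU3Index) :
    (1 : ℝ) ≤ (x.toProd.1 : ℝ) ∧ (1 : ℝ) ≤ (x.toProd.2 : ℝ) := by
  constructor
  · exact_mod_cast x.1.1.pos
  · exact_mod_cast x.1.2.pos

/-- The factor `(m + n) ^ s.re` is at least `m ^ (1/2) * n ^ (1/2)`, which raises both exponents to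
`3 / 2`. -/
theorem summable_zetaPU3Term_natCast_natCast {p q : ℕ} (hp : 1 ≤ p) (hq : 1 ≤ q) {s : ℂ}
    (hs : 1 < s.re) : Summable (zetaPU3Term p q s) := by
  refine summable_PU3Index_of_le (a := 3 / 2) (b := 3 / 2) (by norm_num) (by norm_num) fun x => ?_
  obtain ⟨h1, h2⟩ := x.one_le
  have h3 : 0 < x.toProd.1 + x.toProd.2 := Nat.add_pos_left (Nat.pos_of_ne_zero x.1.1.ne_zero) _
  simp only [zetaPU3Term_natCast_natCast]
  rw [norm_div, norm_div, norm_mul, norm_pow, norm_pow, norm_one,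
    norm_natCast, norm_natCast, norm_natCast_cpow_of_pos h3, Nat.cast_add, div_div,
    one_div_mul_one_div]
  generalize (x.toProd.1 : ℝ) = m at *
  generalize (x.toProd.2 : ℝ) = n at *
  have e1 : ∀ t : ℝ, 1 ≤ t → t ^ (3 / 2 : ℝ) = t * t ^ (1 / 2 : ℝ) := fun t ht => by
    rw [show (3 / 2 : ℝ) = 1 + 1 / 2 by norm_num, Real.rpow_add (by linarith), Real.rpow_one]
  have e2 : ∀ t : ℝ, 1 ≤ t → ∀ k : ℕ, 1 ≤ k → t ≤ t ^ k := fun t ht k hk =>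
    le_self_pow₀ ht (by omega)
  have e3 : m ^ (1 / 2 : ℝ) * n ^ (1 / 2 : ℝ) ≤ (m + n) ^ s.re := by
    calc m ^ (1 / 2 : ℝ) * n ^ (1 / 2 : ℝ) ≤ (m + n) ^ (1 / 2 : ℝ) * (m + n) ^ (1 / 2 : ℝ) := by
          gcongr <;> linarith
      _ = (m + n) ^ (1 : ℝ) := by
          rw [← Real.rpow_add (by linarith)]
          norm_num
      _ ≤ (m + n) ^ s.re := Real.rpow_le_rpow_of_exponent_le (by linarith) hs.le
  refine one_div_le_one_div_of_le (by positivity) ?_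
  rw [e1 m h1, e1 n h2]
  calc m * m ^ (1 / 2 : ℝ) * (n * n ^ (1 / 2 : ℝ)) =
      m * n * (m ^ (1 / 2 : ℝ) * n ^ (1 / 2 : ℝ)) := by ring
    _ ≤ m ^ p * n ^ q * (m + n) ^ s.re := by
        gcongr
        · exact e2 m h1 p hp
        · exact e2 n h2 q hq

theorem summable_zetaPU3Term_natCast_self_natCast {p q : ℕ} (hp : 1 ≤ p) (hq : 1 ≤ q) {s : ℂ}
    (hs : 1 < s.re) : Summable (zetaPU3Term p s q) := by
  refine summable_PU3Index_of_le (a := 2) (b := s.re) (by norm_num) hs fun x => ?_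
  obtain ⟨h1, h2⟩ := x.one_le
  have h3 : 0 < x.toProd.2 := Nat.pos_of_ne_zero x.1.2.ne_zero
  simp only [zetaPU3Term_natCast_self_natCast]
  rw [norm_div, norm_div, norm_mul, norm_pow, norm_pow, norm_one,
    norm_natCast, norm_natCast, norm_natCast_cpow_of_pos h3,
    Nat.cast_add, div_div, one_div_mul_one_div]
  change _ ≤ 1 / ((x.toProd.1 : ℝ) ^ (2 : ℝ) * (x.toProd.2 : ℝ) ^ s.re)
  change 1 / ((x.toProd.1 : ℝ) ^ p * ((x.toProd.1 : ℝ) + x.toProd.2) ^ q *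
    (x.toProd.2 : ℝ) ^ s.re) ≤ _
  generalize (x.toProd.1 : ℝ) = m at *
  generalize (x.toProd.2 : ℝ) = n at *
  refine one_div_le_one_div_of_le (by positivity) ?_
  gcongr
  rw [show (2 : ℝ) = 1 + 1 by norm_num, Real.rpow_add (by linarith), Real.rpow_one]
  gcongr
  · exact le_self_pow₀ h1 (by omega)
  · exact (by linarith : m ≤ m + n).trans (le_self_pow₀ (by linarith) (by omega))

theorem HasSum.antidiagonal {F : ℕ × ℕ → ℂ} {S : ℂ} (h : HasSum F S) :
    HasSum (fun N => ∑ x ∈ Finset.HasAntidiagonal.antidiagonal N, F x) S := by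
  have h1 := ((Finset.HasAntidiagonal.sigmaAntidiagonalEquivProd (A := ℕ)).hasSum_iff).2 h
  exact h1.sigma fun N => Finset.hasSum (Finset.HasAntidiagonal.antidiagonal N) F

theorem LSeriesHasSum_convSum {p q : ℕ} (hp : 1 ≤ p) (hq : 1 ≤ q) {s : ℂ} (hs : 1 < s.re) :
    LSeriesHasSum (convSum p q) s (∑' x, zetaPU3Term p q s x) := by
  have h1 := (summable_zetaPU3Term_natCast_natCast hp hq hs).hasSum
  rw [LSeriesHasSum]
  generalize ∑' x, zetaPU3Term p q s x = S at h1 ⊢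
  rw [zetaPU3Term_natCast_natCast] at h1
  have h2 := (hasSum_PU3Index_iff (F := fun y => 1 / ((y.1 : ℂ) ^ p * (y.2 : ℂ) ^ q) /
      ((y.1 + y.2 : ℕ) : ℂ) ^ s)).1 h1
  have h3 := h2.antidiagonal
  convert h3 using 1
  funext N
  rcases eq_or_ne N 0 with rfl | hN
  · simp
  rw [LSeries.term_of_ne_zero hN, convSum, Finset.sum_div]
  refine Finset.sum_congr rfl fun x hx => ?_
  rw [Finset.HasAntidiagonal.mem_antidiagonal] at hx
  rw [hx, ite_div, zero_div]

theorem hasSum_tailSum {p q : ℕ} (hpq : 2 ≤ p + q) (n : ℕ) :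
    HasSum (fun m : ℕ => if m ≠ 0 ∧ m ≡ n [MOD 3] then
      1 / ((m : ℂ) ^ p * ((m + n : ℕ) : ℂ) ^ q) else 0) (tailSum p q n) := by
  have hinj : Function.Injective fun k : ℕ => res3 n + 3 * k := fun a b h => by
    simp only at h
    omega
  refine (hinj.hasSum_iff ?_).1
    ((summable_one_div_pow_mul_pow n hpq (res3_pos n)).hasSum.congr_fun fun k => ?_)
  · intro m hm
    refine if_neg fun h => hm ⟨(m - res3 n) / 3, ?_⟩
    have h1 := h.1
    have h2 := h.2
    simp only [res3, Nat.ModEq] at h2 ⊢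
    omega
  · refine if_pos ⟨?_, ?_⟩
    · have := res3_pos n
      beta_reduce
      omega
    · simp only [res3, Nat.ModEq]
      omega

theorem LSeriesHasSum_tailSum {p q : ℕ} (hp : 1 ≤ p) (hq : 1 ≤ q) {s : ℂ} (hs : 1 < s.re) :
    LSeriesHasSum (tailSum p q) s (∑' x, zetaPU3Term p s q x) := by
  have h1 := (summable_zetaPU3Term_natCast_self_natCast hp hq hs).hasSum
  rw [LSeriesHasSum]
  generalize ∑' x, zetaPU3Term p s q x = S at h1 ⊢
  rw [zetaPU3Term_natCast_self_natCast] at h1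
  have h2 := (hasSum_PU3Index_iff (F := fun y => 1 / ((y.1 : ℂ) ^ p * ((y.1 + y.2 : ℕ) : ℂ) ^ q) /
      (y.2 : ℂ) ^ s)).1 h1
  have h3 := ((Equiv.prodComm ℕ ℕ).hasSum_iff).2 h2
  refine HasSum.prod_fiberwise h3 fun n => ?_
  rcases eq_or_ne n 0 with rfl | hn
  · simp
  rw [LSeries.term_of_ne_zero hn]
  refine ((hasSum_tailSum (by omega : 2 ≤ p + q) n).div_const _).congr_fun fun m => ?_
  simp only [Function.comp, Equiv.prodComm_apply, Prod.swap, ite_div, zero_div]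
  refine if_congr ?_ rfl rfl
  tauto

/-- The series `∑ 1 / (m ^ p * n ^ q * (m + n) ^ s)` has a meromorphic continuation. -/
theorem exists_isZetaPU3Continuation_right {p q : ℕ} (hp : 1 ≤ p) (hq : 1 ≤ q) :
    ∃ Z, IsZetaPU3Continuation (fun s => ((p : ℂ), (q : ℂ), s)) Z := by
  obtain ⟨Z, hZ, c, hc⟩ := (LSeriesContinues.convSum p q (by omega)).exists_meromorphic
  refine ⟨toMeromorphicNFOn Z univ, fun s hs => summable_zetaPU3Term_natCast_natCast hp hq hs,
    fun s hs => ?_, meromorphicNFOn_toMeromorphicNFOn Z univ⟩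
  beta_reduce at hs ⊢
  rw [zetaPU3Term_natCast_natCast] at hs ⊢
  refine toMeromorphicNFOn_eq_tsum_of_summable hZ
    (b := fun x : PU3Index => x.toProd.1 + x.toProd.2) (fun x => ?_) (c := max c 1)
    (fun z hz => ?_) hs
  · exact Nat.add_pos_left (Nat.pos_of_ne_zero x.1.1.ne_zero) _
  · have h1 := (hc z ((le_max_left _ _).trans_lt hz)).unique
      (LSeriesHasSum_convSum hp hq ((le_max_right _ _).trans_lt hz))
    simpa only [zetaPU3Term_natCast_natCast] using h1

/-- The series `∑ 1 / (m ^ p * n ^ s * (m + n) ^ q)` has a meromorphic continuation. -/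
theorem exists_isZetaPU3Continuation_middle {p q : ℕ} (hp : 1 ≤ p) (hq : 1 ≤ q) :
    ∃ Z, IsZetaPU3Continuation (fun s => ((p : ℂ), s, (q : ℂ))) Z := by
  obtain ⟨Z, hZ, c, hc⟩ := (LSeriesContinues.tailSum p q (by omega)).exists_meromorphic
  refine ⟨toMeromorphicNFOn Z univ, fun s hs => summable_zetaPU3Term_natCast_self_natCast hp hq hs,
    fun s hs => ?_, meromorphicNFOn_toMeromorphicNFOn Z univ⟩
  beta_reduce at hs ⊢
  rw [zetaPU3Term_natCast_self_natCast] at hs ⊢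
  refine toMeromorphicNFOn_eq_tsum_of_summable hZ
    (b := fun x : PU3Index => x.toProd.2) (fun x => ?_) (c := max c 1)
    (fun z hz => ?_) hs
  · exact Nat.pos_of_ne_zero x.1.2.ne_zero
  · have h1 := (hc z ((le_max_left _ _).trans_lt hz)).unique
      (LSeriesHasSum_tailSum hp hq ((le_max_right _ _).trans_lt hz))
    simpa only [zetaPU3Term_natCast_self_natCast] using h1

end DoubleSeries

/-! ### Solving the partial fraction recursion. -/

section PascalRecursion

/-- The solution of Pascal's recursion whose boundary values are given by the sequence `e`. -/
def pascalSum (u : ℂ) (e : ℕ → ℂ) (p q : ℕ) : ℂ :=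
  ∑ j ∈ Finset.range (p + 2), ((p + q + 1 - j).choose q : ℂ) * u ^ (p + q + 2 - j) * e j

theorem pascalSum_succ_zero (u : ℂ) (e : ℕ → ℂ) (p : ℕ) :
    pascalSum u e (p + 1) 0 = u * (pascalSum u e p 0 + e (p + 2)) := by
  rw [pascalSum, Finset.sum_range_succ, pascalSum, mul_add, Finset.mul_sum]
  congr 1
  · refine Finset.sum_congr rfl fun j hj => ?_
    rw [Finset.mem_range] at hj
    rw [show p + 1 + 0 + 2 - j = (p + 0 + 2 - j) + 1 by omega, pow_succ]
    simp only [Nat.choose_zero_right]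
    ring
  · rw [show p + 1 + 0 + 2 - (p + 1 + 1) = 1 by omega]
    simp

theorem pascalSum_zero_succ (u : ℂ) (e : ℕ → ℂ) (q : ℕ) :
    pascalSum u e 0 (q + 1) = u * (pascalSum u e 0 q + e 0 * u ^ (q + 2)) := by
  simp only [pascalSum, Finset.sum_range_succ, Finset.sum_range_zero, zero_add, Nat.sub_zero,
    Nat.choose_succ_self_right, Nat.add_sub_cancel, Nat.choose_self]
  rw [show q + 1 + 2 - 1 = q + 2 by omega, show q + 2 - 1 = q + 1 by omega]
  push_cast
  ring

/-- Pascal's rule for each `j ≤ p + 1`; the last index `j = p + 2` occurs only in `pascalSum u e (p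
+ 1) q` and has binomial coefficient 1 on both sides. -/
theorem pascalSum_succ_succ (u : ℂ) (e : ℕ → ℂ) (p q : ℕ) :
    pascalSum u e (p + 1) (q + 1) =
      u * (pascalSum u e p (q + 1) + pascalSum u e (p + 1) q) := by
  have h : ∀ a b c : ℂ, u * (a + (b + c)) = u * (a + b) + u * c := fun a b c => by ring
  rw [pascalSum, Finset.sum_range_succ, pascalSum, pascalSum, Finset.sum_range_succ _ (p + 1 + 1),
    h, ← Finset.sum_add_distrib, Finset.mul_sum]
  congr 1
  · refine Finset.sum_congr rfl fun j hj => ?_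
    rw [Finset.mem_range] at hj
    obtain ⟨m, hm⟩ : ∃ m, p + q + 2 - j = m := ⟨_, rfl⟩
    rw [show p + 1 + (q + 1) + 2 - j = m + 2 by omega,
      show p + 1 + (q + 1) + 1 - j = m + 1 by omega, show p + (q + 1) + 1 - j = m by omega,
      show p + (q + 1) + 2 - j = m + 1 by omega, show p + 1 + q + 1 - j = m by omega,
      show p + 1 + q + 2 - j = m + 1 by omega, Nat.choose_succ_succ]
    push_cast
    ring
  · rw [show p + 1 + (q + 1) + 1 - (p + 1 + 1) = q + 1 by omega,
      show p + 1 + (q + 1) + 2 - (p + 1 + 1) = q + 2 by omega,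
      show p + 1 + q + 1 - (p + 1 + 1) = q by omega,
      show p + 1 + q + 2 - (p + 1 + 1) = q + 1 by omega, Nat.choose_self, Nat.choose_self]
    ring

/-- The recursion and symmetry determine `T` from its boundary and from `T 1 1`, which is prescribed
separately because the recursion is not assumed there. In the application `u = 1 / n`, and the `e 0`
terms remove the excluded point `x = n`. -/
theorem eq_pascalSum_add {u : ℂ} {e : ℕ → ℂ} {T : ℕ → ℕ → ℂ} (hcomm : ∀ p q, T p q = T q p)
    (h0 : ∀ p, T (p + 2) 0 = e (p + 2) + e 0 * u ^ (p + 2))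
    (h1 : T 1 1 = 2 * u * (e 1 + e 0 * u))
    (hT : ∀ p q, 1 ≤ p + q → T (p + 1) (q + 1) = u * (T p (q + 1) + T (p + 1) q)) :
    ∀ p q, T (p + 1) (q + 1) = pascalSum u e p q + pascalSum u e q p := by
  have hz : ∀ p, T (p + 1) 1 = pascalSum u e p 0 + pascalSum u e 0 p := by
    intro p
    induction p with
    | zero =>
      rw [h1]
      simp [pascalSum, Finset.sum_range_succ]
      ring
    | succ p ih =>
      rw [hT (p + 1) 0 (by omega), ih, h0, pascalSum_succ_zero, pascalSum_zero_succ]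
      ring
  intro p
  induction p with
  | zero =>
    intro q
    rw [hcomm, hz, add_comm]
  | succ p ihp =>
    intro q
    induction q with
    | zero => exact hz (p + 1)
    | succ q ihq =>
      rw [hT _ _ (by omega), ihp, ihq, pascalSum_succ_succ, pascalSum_succ_succ u e q p]
      ring

end PascalRecursion

/-! ### Bernoulli values, and the signed coefficient sum. -/

section BernoulliValues

open Complex

theorem bernoulliValue_one_sub (k : ℕ) (x : ℚ) :
    bernoulliValue k (1 - x) = (-1) ^ k * bernoulliValue k x := by
  rw [bernoulliValue, Polynomial.bernoulli_eval_one_sub]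
  push_cast
  rfl

theorem neg_one_pow_mul_bernoulliValue_zero {k : ℕ} (hk : k ≠ 1) :
    (-1) ^ k * bernoulliValue k 0 = bernoulliValue k 0 := by
  rw [← bernoulliValue_one_sub, sub_zero, bernoulliValue, bernoulliValue,
    Polynomial.bernoulli_eval_zero, Polynomial.bernoulli_eval_one,
    bernoulli_eq_bernoulli'_of_ne_one hk]

theorem bernoulliFun_ratCast (k : ℕ) (x : ℚ) :
    ((bernoulliFun k (x : ℝ) : ℝ) : ℂ) = bernoulliValue k x := by
  rw [bernoulliFun, bernoulliValue, Polynomial.eval_map_algebraMap]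
  have := Polynomial.aeval_algebraMap_apply ℝ x (Polynomial.bernoulli k)
  rw [eq_ratCast] at this
  rw [this]
  simp

/-- The weight `-(2 π i) ^ k / k! ∑ B_k (a / 3) e ^ (2 π i a n / 3)`. -/
noncomputable def bernoulliWeight (k n : ℕ) : ℂ :=
  -((2 * Real.pi * I) ^ k / (k.factorial : ℂ)) *
    ∑ a ∈ Finset.range 3, bernoulliValue k ((a : ℚ) / 3) * root3 ^ (a * n)

theorem bernoulliWeight_zero (n : ℕ) : bernoulliWeight 0 n = if n % 3 = 0 then -3 else 0 := by
  have h : ∀ x : ℚ, bernoulliValue 0 x = 1 := fun x => by simp [bernoulliValue]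
  simp only [bernoulliWeight, h, one_mul, sum_root3_pow]
  split_ifs <;> simp

/-- The extra `πi` is the contribution of `a = 0`, where `B_1(0) = -1/2` instead of the mean value 0
of the sawtooth at its jump. -/
theorem bernoulliWeight_one (n : ℕ) :
    bernoulliWeight 1 n = 3 * reciprocalSum n + Real.pi * I := by
  have h : ∀ x : ℚ, bernoulliValue 1 x = x - 1 / 2 := fun x => by
    simp [bernoulliValue, Polynomial.bernoulli_one]
  simp only [bernoulliWeight, h, Finset.sum_range_succ, Finset.sum_range_zero, reciprocalSum]
  push_cast
  simp
  ring

/-- Reversing the sign of `a` in the weight changes it only for `k = 1`. -/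
theorem bernoulliWeight_reflect {k : ℕ} (hk : k ≠ 1) (n : ℕ) :
    (-1) ^ k * bernoulliWeight k (2 * n) = bernoulliWeight k n := by
  have h1 : bernoulliValue k (2 / 3) = (-1) ^ k * bernoulliValue k (1 / 3) := by
    rw [← bernoulliValue_one_sub]
    norm_num
  have h2 := neg_one_pow_mul_bernoulliValue_zero hk
  have h3 : root3 ^ (2 * (2 * n)) = root3 ^ n := by
    rw [← root3_pow_mod, ← root3_pow_mod n]
    congr 1
    omega
  have h4 : ((-1 : ℂ) ^ k) * (-1) ^ k = 1 := by
    rw [← mul_pow]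
    simp
  simp only [bernoulliWeight, Finset.sum_range_succ, Finset.sum_range_zero, zero_add, zero_mul,
    one_mul, pow_zero, mul_one, Nat.cast_zero, zero_div, Nat.cast_one, Nat.cast_ofNat, h1, h3]
  linear_combination (-((2 * Real.pi * I) ^ k / (k.factorial : ℂ))) *
    (h2 + bernoulliValue k (1 / 3) * root3 ^ n * h4)

theorem bernoulliWeight_one_reflect (n : ℕ) :
    -bernoulliWeight 1 (2 * n) = 3 * reciprocalSum n - Real.pi * I := by
  have h3 : root3 ^ (2 * (2 * n)) = root3 ^ n := by
    rw [← root3_pow_mod, ← root3_pow_mod n]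
    congr 1
    omega
  rw [bernoulliWeight_one, reciprocalSum, reciprocalSum, h3]
  ring

/-- The Fourier series of `B_p` at `0, 1/3, 2/3`, weighted by `root3 ^ (a * n)` and added:
orthogonality keeps the integers `x ≡ 2 * n (mod 3)`, with positive and negative `x` giving the two
tails. -/
theorem three_mul_tailSum_add {p : ℕ} (hp : 2 ≤ p) (n : ℕ) :
    3 * (tailSum p 0 (2 * n) + (-1) ^ p * tailSum p 0 n) = bernoulliWeight p n := by
  have h1 : ∀ a ∈ Finset.range 3, HasSum (fun m : ℕ => 1 / (m : ℂ) ^ p *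
      (root3 ^ (a * (m + n)) + (-1) ^ p * root3 ^ (a * (2 * m + n))))
      (-(2 * Real.pi * I) ^ p / (p.factorial : ℂ) * bernoulliValue p ((a : ℚ) / 3) *
        root3 ^ (a * n)) := by
    intro a ha
    rw [Finset.mem_range] at ha
    have ha' : (a : ℝ) ≤ 3 := by exact_mod_cast ha.le
    have h2 := (hasSum_one_div_nat_pow_mul_fourier hp (x := (a : ℝ) / 3)
      ⟨by positivity, by linarith⟩).mul_right (root3 ^ (a * n))
    have h3 : ((a : ℝ) / 3) = (((a : ℚ) / 3 : ℚ) : ℝ) := by push_cast; rfl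
    rw [h3, bernoulliFun_ratCast, ← h3] at h2
    refine h2.congr_fun fun m => ?_
    rw [fourier_coe_apply, fourier_coe_apply, mul_assoc]
    congr 1
    rw [add_mul, mul_assoc ((-1 : ℂ) ^ p)]
    congr 1
    · rw [mul_add, pow_add, ← exp_mul_eq_root3_pow]
      congr 2
      push_cast
      ring
    · congr 1
      rw [mul_add, pow_add, show a * (2 * m) = 2 * a * m by ring, ← exp_neg_mul_eq_root3_pow]
      congr 2
      push_cast
      ring
  have h2 := hasSum_sum h1
  have h3 : ∑ a ∈ Finset.range 3, -(2 * Real.pi * I) ^ p / (p.factorial : ℂ) *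
      bernoulliValue p ((a : ℚ) / 3) * root3 ^ (a * n) = bernoulliWeight p n := by
    rw [bernoulliWeight, Finset.mul_sum]
    refine Finset.sum_congr rfl fun a _ => ?_
    ring
  rw [h3] at h2
  refine HasSum.unique ?_ h2
  refine (((hasSum_tailSum (p := p) (q := 0) (by omega) (2 * n)).add
    ((hasSum_tailSum (p := p) (q := 0) (by omega) n).mul_left ((-1) ^ p))).mul_left 3).congr_fun
    fun m => ?_
  rw [← Finset.mul_sum, Finset.sum_add_distrib, ← Finset.mul_sum, sum_root3_pow, sum_root3_pow]
  rcases eq_or_ne m 0 with rfl | hm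
  · simp [show p ≠ 0 by omega]
  have e1 : (m ≠ 0 ∧ m ≡ 2 * n [MOD 3]) ↔ (m + n) % 3 = 0 := by
    rw [Nat.ModEq]
    omega
  have e2 : (m ≠ 0 ∧ m ≡ n [MOD 3]) ↔ (2 * m + n) % 3 = 0 := by
    rw [Nat.ModEq]
    omega
  simp only [e1, e2, pow_zero, mul_one]
  split_ifs <;> ring

/-- The sum of `1 / (x ^ p * (n - x) ^ q)` over the integers `x ≠ 0, n` with
`x ≡ n - x (mod 3)`. -/
noncomputable def signedSum (p q n : ℕ) : ℂ :=
  convSum p q n + (-1) ^ p * tailSum p q n + (-1) ^ q * tailSum q p n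

theorem signedSum_comm (p q n : ℕ) : signedSum p q n = signedSum q p n := by
  rw [signedSum, signedSum, convSum_comm]
  ring

theorem natCast_mul_signedSum {p q : ℕ} (hpq : 1 ≤ p + q) (n : ℕ) :
    n * signedSum (p + 1) (q + 1) n = signedSum p (q + 1) n + signedSum (p + 1) q n := by
  have h1 := natCast_mul_convSum p q n
  have h2 := natCast_mul_tailSum hpq n
  have h3 := natCast_mul_tailSum (by omega : 1 ≤ q + p) n
  simp only [signedSum]
  linear_combination h1 + (-1) ^ (p + 1) * h2 + (-1) ^ (q + 1) * h3

/-- The Fourier weights, with the value at `1` corrected to the principal value. -/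
noncomputable def symmWeight (n k : ℕ) : ℂ :=
  if k = 1 then reciprocalSum n else bernoulliWeight k n / 3

theorem signedSum_eq_pascalSum (p q : ℕ) {n : ℕ} (hn : n ≠ 0) :
    signedSum (p + 1) (q + 1) n =
      pascalSum (1 / n) (symmWeight n) p q + pascalSum (1 / n) (symmWeight n) q p := by
  have h0 : (n : ℂ) ≠ 0 := by exact_mod_cast hn
  have hw : symmWeight n 0 = -(if n % 3 = 0 then 1 else 0) := by
    rw [symmWeight, if_neg (by norm_num), bernoulliWeight_zero]
    split_ifs <;> norm_num
  refine eq_pascalSum_add (T := fun p q => signedSum p q n)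
    (fun p q => signedSum_comm p q n) (fun p => ?_) ?_ (fun p q hpq => ?_) p q
  · have h1 := three_mul_tailSum_add (by omega : 2 ≤ p + 2) n
    have h2 := tailSum_zero_left_add_powerSum (by omega : 2 ≤ p + 2) n
    rw [hw, symmWeight, if_neg (by omega), ← h1, ← h2, signedSum, convSum_zero_right (by omega)]
    split_ifs <;> ring
  -- At `(1, 1)` the harmonic partial sums from `convSum` and from the two tails cancel, leaving
  -- `reciprocalSum` and the excluded endpoint.
  · have h1 := natCast_mul_convSum 0 0 n
    have h2 := natCast_mul_tailSum_one_one_eq n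
    rw [convSum_comm 0, convSum_zero_right (by norm_num)] at h1
    rw [hw, symmWeight, if_pos rfl, signedSum]
    simp only [zero_add] at h1
    have h3 : (n : ℂ) * (convSum 1 1 n + (-1) ^ 1 * tailSum 1 1 n + (-1) ^ 1 * tailSum 1 1 n) =
        2 * (reciprocalSum n - if n % 3 = 0 then 1 / (n : ℂ) ^ 1 else 0) := by
      linear_combination h1 - 2 * h2
    rw [← mul_right_inj' h0, h3]
    split_ifs <;> field_simp <;> ring
  · have h1 := natCast_mul_signedSum hpq n
    field_simp
    linear_combination h1

end BernoulliValues

/-! ### From coefficients to Lerch functions. -/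

section FunctionalRelation

open Complex Filter Topology Set

theorem pascalSum_add_single (u c : ℂ) (e : ℕ → ℂ) (p q : ℕ) :
    pascalSum u (fun j => e j + if j = 1 then c else 0) p q =
      pascalSum u e p q + ((p + q).choose q : ℂ) * u ^ (p + q + 1) * c := by
  simp only [pascalSum, mul_add, Finset.sum_add_distrib, mul_ite, mul_zero]
  rw [Finset.sum_ite_eq' (Finset.range (p + 2)) 1, if_pos (Finset.mem_range.2 (by omega)),
    show p + q + 1 - 1 = p + q by omega, show p + q + 2 - 1 = p + q + 1 by omega]

theorem mul_pascalSum (c u : ℂ) (e : ℕ → ℂ) (p q : ℕ) :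
    c * pascalSum u e p q = pascalSum u (fun j => c * e j) p q := by
  simp only [pascalSum, Finset.mul_sum]
  exact Finset.sum_congr rfl fun j _ => by ring

/-- Replacing the principal value at `k = 1` by the Bernoulli weight changes the two sums by
opposite multiples of `πi`, with coefficients `(p + q).choose q` and `(p + q).choose p`; these are
equal, so the changes cancel. For `k ≠ 1` the reflected weight is the original one. -/
theorem three_mul_signedSum (p q : ℕ) {n : ℕ} (hn : n ≠ 0) :
    3 * signedSum (p + 1) (q + 1) n =
      pascalSum (1 / n) (fun k => (-1) ^ k * bernoulliWeight k (2 * n)) p q +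
      pascalSum (1 / n) (fun k => bernoulliWeight k n) q p := by
  have h1 : (fun k => 3 * symmWeight n k) = fun k => (-1) ^ k * bernoulliWeight k (2 * n) +
      if k = 1 then Real.pi * I else 0 := by
    funext k
    by_cases hk : k = 1
    · subst hk
      simp only [symmWeight, if_true, pow_one]
      linear_combination -bernoulliWeight_one_reflect n
    · rw [bernoulliWeight_reflect hk, symmWeight, if_neg hk, if_neg hk]
      ring
  have h2 : (fun k => 3 * symmWeight n k) = fun k => bernoulliWeight k n +
      if k = 1 then -(Real.pi * I) else 0 := by
    funext k
    by_cases hk : k = 1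
    · subst hk
      simp only [symmWeight, if_true]
      linear_combination -bernoulliWeight_one n
    · rw [symmWeight, if_neg hk, if_neg hk]
      ring
  rw [signedSum_eq_pascalSum p q hn, mul_add, mul_pascalSum, mul_pascalSum, h1,
    pascalSum_add_single, ← h1, h2, pascalSum_add_single, add_comm q p, Nat.choose_symm_add]
  ring

theorem LSeriesHasSum_root3_pow {a k : ℕ} {s : ℂ} (hs : 1 < (s + k).re) :
    LSeriesHasSum (fun n => root3 ^ (a * n) / (n : ℂ) ^ k) s (lerchPhi (s + k) ((a : ℝ) / 3)) :=
  LSeriesHasSum_div_pow.2 ((HurwitzZeta.LSeriesHasSum_exp ((a : ℝ) / 3) hs).congr_fun fun n =>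
    LSeries.term_congr (fun {n} _ => (exp_mul_eq_root3_pow a n).symm) _ n)

theorem LSeriesHasSum_root3_pow_neg {a k : ℕ} {s : ℂ} (hs : 1 < (s + k).re) :
    LSeriesHasSum (fun n => root3 ^ (a * (2 * n)) / (n : ℂ) ^ k) s
      (lerchPhi (s + k) (-((a : ℝ) / 3))) :=
  LSeriesHasSum_div_pow.2 ((HurwitzZeta.LSeriesHasSum_exp (-((a : ℝ) / 3)) hs).congr_fun fun n =>
    LSeries.term_congr (fun {n} _ => by
      rw [exp_neg_mul_eq_root3_pow]
      congr 1
      ring) _ n)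

/-- The sum over `τ` attached to weights `ε τ` and Dirichlet series `Φ a`. -/
noncomputable def lerchSum (p q : ℕ) (ε : ℕ → ℂ) (Φ : ℕ → ℂ → ℂ) (s : ℂ) : ℂ :=
  ∑ τ ∈ Finset.range (p + 1), ((p + q - τ - 1).choose (q - 1) : ℂ) * ε τ *
    ((2 * Real.pi * I) ^ τ / (τ.factorial : ℂ)) *
    ∑ a ∈ Finset.range 3, bernoulliValue τ ((a : ℚ) / 3) * Φ a (s + p + q - τ)

theorem LSeriesHasSum_pascalSum {p q : ℕ} {ε : ℕ → ℂ} {Φ : ℕ → ℂ → ℂ} {r : ℕ} {s : ℂ}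
    (hs : 1 < s.re)
    (hΦ : ∀ a k : ℕ, 1 < (s + k).re →
      LSeriesHasSum (fun n => root3 ^ (a * (r * n)) / (n : ℂ) ^ k) s (Φ a (s + k))) :
    LSeriesHasSum (fun n => pascalSum (1 / n) (fun k => ε k * bernoulliWeight k (r * n)) p q) s
      (-lerchSum (p + 1) (q + 1) ε Φ s) := by
  have h1 : ∀ τ ∈ Finset.range (p + 1 + 1), ∀ a ∈ Finset.range 3,
      LSeriesHasSum (fun n => root3 ^ (a * (r * n)) / (n : ℂ) ^ (p + q + 2 - τ)) s
        (Φ a (s + (p + 1 : ℕ) + (q + 1 : ℕ) - τ)) := by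
    intro τ hτ a _
    rw [Finset.mem_range] at hτ
    convert hΦ a (p + q + 2 - τ) ?_ using 2
    · rw [Nat.cast_sub (by omega)]
      push_cast
      ring
    · rw [add_re, natCast_re]
      have : (0 : ℝ) ≤ ((p + q + 2 - τ : ℕ) : ℝ) := by positivity
      linarith
  have h2 := LSeriesHasSum.sum fun τ hτ => ((LSeriesHasSum.sum fun a ha =>
    ((h1 τ hτ a ha).smul (bernoulliValue τ ((a : ℚ) / 3)))).smul
      (-(((p + 1 + (q + 1) - τ - 1).choose (q + 1 - 1) : ℂ) * ε τ *
        ((2 * Real.pi * I) ^ τ / (τ.factorial : ℂ)))))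
  convert h2 using 1
  · funext n
    simp only [pascalSum, Finset.sum_apply, Pi.smul_apply, smul_eq_mul, bernoulliWeight,
      Finset.mul_sum]
    refine Finset.sum_congr rfl fun τ _ => Finset.sum_congr rfl fun a _ => ?_
    rw [show p + 1 + (q + 1) - τ - 1 = p + q + 1 - τ by omega, Nat.add_sub_cancel, one_div, inv_pow]
    ring
  · simp only [lerchSum, neg_mul, Finset.sum_neg_distrib]

/-- Both sides are sums of Dirichlet series whose coefficients agree for every `n ≠ 0` by
`three_mul_signedSum`. -/
theorem three_mul_zeta_add_eq {p q : ℕ} (hp : 1 ≤ p) (hq : 1 ≤ q) {s : ℂ} (hs : 1 < s.re) :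
    3 * (∑' x, zetaPU3Term p q s x + (-1) ^ p * ∑' x, zetaPU3Term p s q x +
      (-1) ^ q * ∑' x, zetaPU3Term q s p x) =
      -lerchSum p q (fun τ => (-1) ^ τ) (fun a z => lerchPhi z (-((a : ℝ) / 3))) s -
        lerchSum q p (fun _ => 1) (fun a z => lerchPhi z ((a : ℝ) / 3)) s := by
  have h1 := (((LSeriesHasSum_convSum hp hq hs).add ((LSeriesHasSum_tailSum hp hq hs).smul
    ((-1) ^ p))).add ((LSeriesHasSum_tailSum hq hp hs).smul ((-1) ^ q))).smul 3
  obtain ⟨P, rfl⟩ : ∃ P, p = P + 1 := ⟨p - 1, by omega⟩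
  obtain ⟨Q, rfl⟩ : ∃ Q, q = Q + 1 := ⟨q - 1, by omega⟩
  have h2 := LSeriesHasSum_pascalSum (p := P) (q := Q) (ε := fun τ => (-1) ^ τ) (r := 2)
    (Φ := fun a z => lerchPhi z (-((a : ℝ) / 3))) hs fun a k hk => LSeriesHasSum_root3_pow_neg hk
  have h3 := LSeriesHasSum_pascalSum (p := Q) (q := P) (ε := fun _ => 1) (r := 1)
    (Φ := fun a z => lerchPhi z ((a : ℝ) / 3)) hs fun a k hk => by
      simpa only [one_mul] using LSeriesHasSum_root3_pow hk
  rw [sub_eq_add_neg]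
  refine h1.unique (((LSeriesHasSum_congr s _ fun {n} hn => ?_)).1 (h2.add h3))
  have h4 := three_mul_signedSum P Q hn
  simp only [Pi.add_apply, Pi.smul_apply, smul_eq_mul, one_mul]
  rw [← h4, signedSum]

theorem meromorphicAt_lerchPhi (α : ℝ) (s : ℂ) : MeromorphicAt (fun z => lerchPhi z α) s :=
  meromorphic_expZeta α s

theorem analyticAt_lerchPhi (α : ℝ) {s : ℂ} (hs : s ≠ 1) : AnalyticAt ℂ (fun z => lerchPhi z α) s := by
  refine Complex.analyticAt_iff_eventually_differentiableAt.2 ?_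
  filter_upwards [isOpen_ne.mem_nhds hs] with z hz
  exact HurwitzZeta.differentiableAt_expZeta _ z (Or.inl hz)

theorem meromorphicAt_lerchSum (p q : ℕ) (ε : ℕ → ℂ) (α : ℕ → ℝ) (s : ℂ) :
    MeromorphicAt (lerchSum p q ε fun a z => lerchPhi z (α a)) s := by
  refine MeromorphicAt.fun_sum fun τ _ => (MeromorphicAt.const _ s).fun_mul
    (MeromorphicAt.fun_sum fun a _ => (MeromorphicAt.const _ s).fun_mul ?_)
  exact (meromorphicAt_lerchPhi (α a) (s + p + q - τ)).comp_analyticAt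
    (g := fun z : ℂ => z + p + q - τ) (by fun_prop)

theorem analyticAt_lerchSum (p q : ℕ) (ε : ℕ → ℂ) (α : ℕ → ℝ) {s : ℂ}
    (hs : ∀ τ : ℕ, τ ≤ p → s + p + q - τ ≠ 1) :
    AnalyticAt ℂ (lerchSum p q ε fun a z => lerchPhi z (α a)) s := by
  refine Finset.analyticAt_fun_sum _ fun τ hτ => analyticAt_const.fun_mul
    (Finset.analyticAt_fun_sum _ fun a _ => analyticAt_const.fun_mul ?_)
  exact (analyticAt_lerchPhi (α a) (hs τ (by simpa [Nat.lt_succ_iff] using hτ))).comp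
    (f := fun z : ℂ => z + p + q - τ) (by fun_prop)

end FunctionalRelation

theorem mainTheorem3 (p q : ℕ) (hp : 1 ≤ p) (hq : 1 ≤ q) :
    ∃ Z₁ Z₂ Z₃ : ℂ → ℂ,
      IsZetaPU3Continuation (fun s => ((p : ℂ), (q : ℂ), s)) Z₁ ∧
      IsZetaPU3Continuation (fun s => ((p : ℂ), s, (q : ℂ))) Z₂ ∧
      IsZetaPU3Continuation (fun s => ((q : ℂ), s, (p : ℂ))) Z₃ ∧
      ∀ s : ℂ, AnalyticAt ℂ Z₁ s → AnalyticAt ℂ Z₂ s → AnalyticAt ℂ Z₃ s →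
        (∀ τ : ℕ, τ ≤ max p q → s + p + q - τ ≠ 1) →
        3 * (Z₁ s + (-1) ^ p * Z₂ s + (-1) ^ q * Z₃ s) =
          -(∑ τ ∈ Finset.range (p + 1), ((p + q - τ - 1).choose (q - 1) : ℂ) * (-1) ^ τ *
              ((2 * Real.pi * Complex.I) ^ τ / (τ.factorial : ℂ)) *
              ∑ a ∈ Finset.range 3,
                bernoulliValue τ ((a : ℚ) / 3) * lerchPhi (s + p + q - τ) (-((a : ℝ) / 3)))
          - ∑ τ ∈ Finset.range (q + 1), ((p + q - τ - 1).choose (p - 1) : ℂ) *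
              ((2 * Real.pi * Complex.I) ^ τ / (τ.factorial : ℂ)) *
              ∑ a ∈ Finset.range 3,
                bernoulliValue τ ((a : ℚ) / 3) * lerchPhi (s + p + q - τ) ((a : ℝ) / 3) := by
  obtain ⟨Z₁, h₁⟩ := exists_isZetaPU3Continuation_right hp hq
  obtain ⟨Z₂, h₂⟩ := exists_isZetaPU3Continuation_middle hp hq
  obtain ⟨Z₃, h₃⟩ := exists_isZetaPU3Continuation_middle hq hp
  refine ⟨Z₁, Z₂, Z₃, h₁, h₂, h₃, fun s a₁ a₂ a₃ hs => ?_⟩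
  have hs' : ∀ τ : ℕ, τ ≤ max p q → s + q + p - τ ≠ 1 := fun τ hτ => by
    rw [add_right_comm]
    exact hs τ hτ
  set L : ℂ → ℂ := fun z => 3 * (Z₁ z + (-1) ^ p * Z₂ z + (-1) ^ q * Z₃ z) with hL
  set R : ℂ → ℂ := fun z =>
    -lerchSum p q (fun τ => (-1) ^ τ) (fun a z => lerchPhi z (-((a : ℝ) / 3))) z -
      lerchSum q p (fun _ => 1) (fun a z => lerchPhi z ((a : ℝ) / 3)) z with hR
  have hLR : ∀ z : ℂ, 1 < z.re → L z = R z := by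
    intro z hz
    rw [hL, hR]
    simp only
    rw [← three_mul_zeta_add_eq hp hq hz, h₁.eq_tsum z (h₁.summable z hz),
      h₂.eq_tsum z (h₂.summable z hz), h₃.eq_tsum z (h₃.summable z hz)]
  have hLm : ∀ z, MeromorphicAt L z := by
    intro z
    have m₁ := (h₁.meromorphic (Set.mem_univ z)).meromorphicAt
    have m₂ := (h₂.meromorphic (Set.mem_univ z)).meromorphicAt
    have m₃ := (h₃.meromorphic (Set.mem_univ z)).meromorphicAt
    rw [hL]
    fun_prop
  have hRm : ∀ z, MeromorphicAt R z := fun z =>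
    (meromorphicAt_lerchSum p q _ (fun a => -((a : ℝ) / 3)) z).fun_neg.fun_sub
      (meromorphicAt_lerchSum q p _ (fun a => (a : ℝ) / 3) z)
  have hLa : AnalyticAt ℂ L s := by
    rw [hL]
    fun_prop
  have hRa : AnalyticAt ℂ R s :=
    (analyticAt_lerchSum p q _ (fun a => -((a : ℝ) / 3))
      fun τ hτ => hs τ (hτ.trans (le_max_left _ _))).fun_neg.fun_sub
      (analyticAt_lerchSum q p _ (fun a => (a : ℝ) / 3)
        fun τ hτ => hs' τ (hτ.trans (le_max_right _ _)))
  -- The identity theorem gives equality only on a punctured neighbourhood of `s`; analyticity of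
  -- both sides at `s` fills in the point.
  have hev := MeromorphicOn.eventuallyEq_of_eq_re (A := s.re - 1) (fun z _ => hLm z)
    (fun z _ => hRm z) hLR (by linarith : s.re - 1 < s.re)
  have heq := ((hLa.meromorphicNFAt.eventuallyEq_nhdsNE_iff_eventuallyEq_nhds
    hRa.meromorphicNFAt).1 hev).eq_of_nhds
  rw [hL, hR] at heq
  simpa only [lerchSum, mul_one, add_comm q p, add_right_comm s (q : ℂ) (p : ℂ)] using heq
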